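/- **Setting.** Let $d\ge 1$, let $\mathcal M^d$ be the space of probability measures on $\{\pm e_i\}_{i=1}^d$ and $\Omega=(\mathcal M^d)^{\mathbb Z^d}$ the space of environments. For $\omega\in\Omega$ and $z\in\mathbb Z^d$ let $P_\omega^z$ be the law on $(\mathbb Z^d)^{\mathbb N}$ of the Markov chain $\{X_n\}$ with $X_0=z$ and transition probabilities $P_\omega(X_{n+1}=x+e\mid X_n=x)=\omega(x,e)$. Let $Q$ be a probability measure on $\mathcal M^d$ that is uniformly elliptic: there is $\varepsilon>0$ with $Q(\{p: p(e)<\varepsilon\})=0$ for every $e\in\{\pm e_i\}$. Put $P=Q^{\mathbb Z^d}$ and $\mathbf P=P\otimes P_\omega^0$ (the joint law of the environment and the walk). Let $\ell=e_1$, let $A_\ell=\{\lim_{n\to\infty}\langle X_n,\ell\rangle=\infty\}$ be the event of transience in the direction $\ell$, and assume $\mathbf P(A_\ell)>0$. **Regeneration slabs.** A time $t\ge 0$ is a regeneration time if $\langle X_s,\ell\rangle<\langle X_t,\ell\rangle$ for all $0\le s<t$ and $\langle X_s,\ell\rangle>\langle X_t,\ell\rangle$ for all $s>t$. Let $t_1<t_2$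 be the first two regeneration times (on $A_\ell$ they exist almost surely), and for $L>0$ let $\mathcal K_L=\{z\in\mathbb Z^d: 0\le\langle z,\ell\rangle<L\}$. The first regeneration slab is $S_1=\{L,W,u,K\}$, where $L=\langle X_{t_2},\ell\rangle-\langle X_{t_1},\ell\rangle$, $W(z)=\omega(z+X_{t_1})$ for $z\in\mathcal K_L$, $u=t_2-t_1$, and $K(t)=X_{t_1+t}-X_{t_1}$ for $0\le t\le u$. Let $\lambda$ be the law of $S_1$ under $\mathbf P(\,\cdot\mid A_\ell)$. **Backward path.** Let $S_n=\{L_n,W_n,u_n,K_n\}$, $n\in\mathbb Z$, be i.i.d. with law $\lambda$. Define $Y_0=0$ and $Y_{n+1}=Y_n+K_n(u_n)$ for all $n\in\mathbb Z$. Almost surely $\mathbb Z^d$ is the disjoint union of the sets $Y_n+\mathcal K_{L_n}$; let $n(z)$ be the unique $n$ with $z\in Y_n+\mathcal K_{L_n}$. Let $\tilde\omega(z)=W_{n(z)}(z-Y_{n(z)})$ and $\mathcal T=\bigcup_{n\in\mathbb Z}(Y_n+K_n[0,u_n])$. Let $\mu$ be the joint law of $(\tilde\omega,\mathcal T)$ and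 $\tilde\mu$ its marginal law of $\tilde\omega$. **Proposition 3.2.** Let $\tilde\omega$ be sampled from $\tilde\mu$ and, given $\tilde\omega$, let $\{X_n\}$ be a random walk in the environment $\tilde\omega$ started at a site $z\in\mathbb Z^d$ (for instance $z=0$). Then almost surely $\{X_n\}$ is transient in the direction $\ell$; that is, for every $z\in\mathbb Z^d$, $$(\tilde\mu\otimes P_{\tilde\omega}^{z})\Bigl(\lim_{n\to\infty}\langle X_n,\ell\rangle=\infty\Bigr)=1 .$$ -/

import Mathlib

open MeasureTheory ProbabilityTheory Filter Finset

noncomputable section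

namespace RWRE

/-! ### Environments -/

/-- The lattice `ℤ^d` (with its discrete σ-algebra, which is the product one). -/
abbrev Lattice (d : ℕ) : Type := Fin d → ℤ

/-- The set `{±e_i}` of the `2d` unit steps of `ℤ^d`. -/
def unitSteps (d : ℕ) : Set (Lattice d) :=
  {v | ∃ i : Fin d, v = Pi.single i 1 ∨ v = Pi.single i (-1)}

/-- The space `{±e_i}` as a type. -/
abbrev Step (d : ℕ) : Type := ↥(unitSteps d)

/-- The space of all probability measures on `{±e_i}`. -/
abbrev StepLaw (d : ℕ) : Type := ProbabilityMeasure (Step d)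

/-- The space `Ω` of environments: a step law at every site. -/
abbrev Env (d : ℕ) : Type := Lattice d → StepLaw d

/-- The space of trajectories `(ℤ^d)^ℕ`. -/
abbrev Path (d : ℕ) : Type := ℕ → Lattice d

/-- The i.i.d. law `P = Q^{ℤ^d}` on environments. -/
def envLaw {d : ℕ} (Q : Measure (StepLaw d)) : Measure (Env d) :=
  Measure.infinitePi fun _ : Lattice d => Q

/-- Uniform ellipticity: there is `ε > 0` such that every one of the `2d` steps has
`Q`-almost surely probability at least `ε`. -/
def UniformlyElliptic {d : ℕ} (Q : Measure (StepLaw d)) : Prop :=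
  ∃ ε : NNReal, 0 < ε ∧ ∀ e : Step d, Q {p | p {e} < ε} = 0

/-! ### The walk in a fixed environment -/

/-- The transition kernel of the walk in the environment `ω`, as a function of the history up to
time `n`: from the current position `h n` the walk jumps to `h n + e` with probability
`ω (h n) {e}`. -/
def stepKernel {d : ℕ} (ω : Env d) (n : ℕ) : Kernel (Iic n → Lattice d) (Lattice d) :=
  Kernel.ofFunOfCountable fun h =>
    Measure.map (fun e : Step d => h ⟨n, mem_Iic.2 le_rfl⟩ + (e : Lattice d))
      (ω (h ⟨n, mem_Iic.2 le_rfl⟩)).toMeasure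

instance {d : ℕ} (ω : Env d) (n : ℕ) : IsMarkovKernel (stepKernel ω n) :=
  ⟨fun h => Measure.isProbabilityMeasure_map
    (μ := (ω (h ⟨n, mem_Iic.2 le_rfl⟩)).toMeasure)
    (f := fun e : Step d => h ⟨n, mem_Iic.2 le_rfl⟩ + (e : Lattice d))
    Measurable.of_discrete.aemeasurable⟩

/-- The quenched law `P_ω^z`: the law on trajectories of the Markov chain started at `z` with the
transition kernel given by `ω`. -/
def quenchedLaw {d : ℕ} (ω : Env d) (z : Lattice d) : Measure (Path d) :=
  Kernel.traj (X := fun _ => Lattice d) (stepKernel ω) 0 fun _ => z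

instance {d : ℕ} (ω : Env d) (z : Lattice d) : IsProbabilityMeasure (quenchedLaw ω z) := by
  unfold quenchedLaw; infer_instance

theorem measurable_stepKernel {d n : ℕ} (h : Iic n → Lattice d) :
    Measurable fun ω : Env d => stepKernel ω n h := by
  have h1 : Measurable fun ω : Env d =>
      (ω (h ⟨n, mem_Iic.2 le_rfl⟩)).toMeasure :=
    measurable_subtype_coe.comp (measurable_pi_apply _)
  exact (Measure.measurable_map _ Measurable.of_discrete).comp h1

theorem measurable_quenchedLaw {d : ℕ} (z : Lattice d) :
    Measurable fun ω : Env d => quenchedLaw ω z := by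
  have key : ∀ b : ℕ, Measurable fun ω : Env d =>
      Kernel.partialTraj (X := fun _ => Lattice d) (stepKernel ω) 0 b fun _ => z := by
    intro b
    induction b with
    | zero => simp
    | succ b ih =>
      refine Measure.measurable_of_measurable_coe _ fun s hs => ?_
      have h1 : ∀ ω : Env d,
          Kernel.partialTraj (X := fun _ => Lattice d) (stepKernel ω) 0 (b + 1) (fun _ => z) s =
          ∑' h : (Iic b → Lattice d),
            Kernel.partialTraj (X := fun _ => Lattice d) (stepKernel ω) b (b + 1) h s *
            Kernel.partialTraj (X := fun _ => Lattice d) (stepKernel ω) 0 b (fun _ => z) {h} := by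
        intro ω
        rw [Kernel.partialTraj_succ_eq_comp (Nat.zero_le b), Kernel.comp_apply' _ _ _ hs,
          lintegral_countable']
      simp_rw [h1]
      refine Measurable.tsum fun h => Measurable.mul ?_ ?_
      · have h2 : ∀ ω : Env d,
            Kernel.partialTraj (X := fun _ => Lattice d) (stepKernel ω) b (b + 1) h s =
            stepKernel ω b h
              ((fun x => IicProdIoc (X := fun _ => Lattice d) b (b + 1)
                (h, MeasurableEquiv.piSingleton (X := fun _ => Lattice d) b x)) ⁻¹' s) := by
          intro ω
          have hm : Measurable fun x : Lattice d =>
              IicProdIoc (X := fun _ => Lattice d) b (b + 1)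
                (h, MeasurableEquiv.piSingleton (X := fun _ => Lattice d) b x) := by fun_prop
          have hp : MeasurableSet
              (IicProdIoc (X := fun _ => Lattice d) b (b + 1) ⁻¹' s) := measurable_IicProdIoc hs
          rw [Kernel.partialTraj_succ_self, Kernel.map_apply' _ (by fun_prop) _ hs,
            Kernel.prod_apply, Kernel.id_apply, Measure.prod_apply hp,
            lintegral_dirac, Kernel.map_apply' _ (by fun_prop) _ (measurable_prodMk_left hp)]
          rfl
        simp_rw [h2]
        exact (Measure.measurable_coe (by
          exact MeasurableSet.of_discrete)).comp (measurable_stepKernel h)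
      · exact (Measure.measurable_coe (measurableSet_singleton h)).comp ih
  refine Measurable.measure_of_isPiSystem_of_isProbabilityMeasure
    (generateFrom_measurableCylinders (α := fun _ : ℕ => Lattice d)).symm
    isPiSystem_measurableCylinders fun s hs => ?_
  obtain ⟨I, S, hS, rfl⟩ := (mem_measurableCylinders _).1 hs
  obtain ⟨b, hb⟩ := I.exists_nat_subset_range
  have hI : I ⊆ Iic b := fun i hi => mem_Iic.2 (mem_range.1 (hb hi)).le
  have h3 : ∀ ω : Env d, quenchedLaw ω z (cylinder I S) =
      Kernel.partialTraj (X := fun _ => Lattice d) (stepKernel ω) 0 b (fun _ => z)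
        (restrict₂ (π := fun _ => Lattice d) hI ⁻¹' S) := by
    intro ω
    rw [← Kernel.traj_map_frestrictLe_apply, Measure.map_apply (by fun_prop)
      (measurable_restrict₂ (X := fun _ => Lattice d) hI hS)]
    rfl
  simp_rw [h3]
  exact (Measure.measurable_coe (measurable_restrict₂ (X := fun _ => Lattice d) hI hS)).comp
    (key b)

/-- The quenched laws `ω ↦ P_ω^z` as a kernel from environments to trajectories. -/
def quenchedKernel {d : ℕ} (z : Lattice d) : Kernel (Env d) (Path d) where
  toFun ω := quenchedLaw ω z
  measurable' := measurable_quenchedLaw z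

instance {d : ℕ} (z : Lattice d) : IsMarkovKernel (quenchedKernel z) :=
  ⟨fun ω => inferInstanceAs (IsProbabilityMeasure (quenchedLaw ω z))⟩

/-- For a law `ν` on environments, the joint law `ν ⊗ P_ω^z` of an environment `ω` sampled from `ν`
and a walk in `ω` started at `z`. -/
def jointLaw {d : ℕ} (ν : Measure (Env d)) (z : Lattice d) : Measure (Env d × Path d) :=
  ν ⊗ₘ quenchedKernel z

/-! ### The direction `ℓ = e₁` and regeneration slabs -/

variable {d : ℕ} [NeZero d]

/-- The level `⟨z, ℓ⟩` of a site in the direction `ℓ = e₁`, the first coordinate vector. -/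
def level (z : Lattice d) : ℤ := z 0

/-- The event `A_ℓ` that the walk is transient in the direction `ℓ`: `⟨X_n, ℓ⟩ → ∞`. -/
def transientPaths (d : ℕ) [NeZero d] : Set (Path d) :=
  {X | Tendsto (fun n => level (X n)) atTop atTop}

/-- The time `t` is a regeneration time of `X` in the direction `ℓ`. -/
def IsRegenerationTime (X : Path d) (t : ℕ) : Prop :=
  (∀ s, s < t → level (X s) < level (X t)) ∧ ∀ s, t < s → level (X t) < level (X s)

/-- The regeneration times in increasing order, with indices starting at `0` (`regTime X 0` is the
first one). The value is `0` if there are not enough regeneration times. -/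
def regTime (X : Path d) (n : ℕ) : ℕ := Nat.nth (IsRegenerationTime X) n

/-- The set `𝒦_L = {z | 0 ≤ ⟨z, ℓ⟩ < L}`. -/
def slabSites (d : ℕ) [NeZero d] (L : ℤ) : Set (Lattice d) := {z | 0 ≤ level z ∧ level z < L}

instance : Inhabited (Step d) := ⟨⟨Pi.single 0 1, 0, Or.inl rfl⟩⟩

/-- A fixed step law, used only as a placeholder at sites where an environment is not specified. -/
def defaultLaw (d : ℕ) [NeZero d] : StepLaw d := default

/-- A regeneration slab `{L, W, u, K}`: a width `L`, an environment `W` on `𝒦_L`, a duration `u`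
and a path `K` on `[0, u]`. So that all slabs live in one space, `W` is extended by the
placeholder outside `𝒦_L`, and `K` is extended by its final value after time `u`. -/
structure Slab (d : ℕ) where
  L : ℤ
  W : Env d
  u : ℕ
  K : Path d

/-- The product σ-algebra on slabs. -/
instance {d : ℕ} : MeasurableSpace (Slab d) :=
  MeasurableSpace.comap (fun S : Slab d => (S.L, S.W, S.u, S.K)) inferInstance

open Classical in
/-- The first regeneration slab `S_1` of the walk `X` in the environment `ω`, between the first two
regeneration times. (Only meaningful when these exist.) -/
def firstSlab (ω : Env d) (X : Path d) : Slab d where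
  L := level (X (regTime X 1)) - level (X (regTime X 0))
  W := fun z =>
    if z ∈ slabSites d (level (X (regTime X 1)) - level (X (regTime X 0)))
    then ω (z + X (regTime X 0)) else defaultLaw d
  u := regTime X 1 - regTime X 0
  K := fun t => X (regTime X 0 + min t (regTime X 1 - regTime X 0)) - X (regTime X 0)

/-- The law `λ` of the first regeneration slab under `𝐏 = P ⊗ P_ω^0` conditioned on `A_ℓ`. -/
def slabLaw (Q : Measure (StepLaw d)) : Measure (Slab d) :=
  (cond (jointLaw (envLaw Q) 0) (Prod.snd ⁻¹' transientPaths d)).map fun p => firstSlab p.1 p.2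

/-! ### Gluing a doubly infinite sequence of slabs -/

/-- The gluing points: `Y 0 = 0` and `Y (n + 1) = Y n + K_n(u_n)` for every integer `n`. -/
def gluePoint {d : ℕ} (S : ℤ → Slab d) : ℤ → Lattice d
  | Int.ofNat n => ∑ k ∈ range n, (S k).K (S k).u
  | Int.negSucc n => -∑ k ∈ range (n + 1), (S (-(k + 1))).K (S (-(k + 1))).u

theorem gluePoint_zero {d : ℕ} (S : ℤ → Slab d) : gluePoint S 0 = 0 := by
  change ∑ k ∈ range 0, (S k).K (S k).u = 0
  simp

theorem gluePoint_add_one {d : ℕ} (S : ℤ → Slab d) (n : ℤ) :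
    gluePoint S (n + 1) = gluePoint S n + (S n).K (S n).u := by
  rcases n with n | n
  · change ∑ k ∈ range (n + 1), (S k).K (S k).u = ∑ k ∈ range n, (S k).K (S k).u + _
    rw [sum_range_succ]
    rfl
  · have hn : (Int.negSucc n : ℤ) = -((n : ℤ) + 1) := Int.negSucc_eq n
    have h1 : gluePoint S (Int.negSucc n) =
        -∑ k ∈ range (n + 1), (S (-(k + 1))).K (S (-(k + 1))).u := rfl
    have h2 : gluePoint S (Int.negSucc n + 1) =
        -∑ k ∈ range n, (S (-(k + 1))).K (S (-(k + 1))).u := by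
      rcases n with n | n
      · change ∑ k ∈ range 0, (S k).K (S k).u = _
        simp
      · rfl
    rw [h1, h2, sum_range_succ, hn]
    abel

/-- The site `z` belongs to the `n`-th glued slab `Y n + 𝒦_{L_n}`. -/
def InSlab (S : ℤ → Slab d) (z : Lattice d) (n : ℤ) : Prop :=
  z - gluePoint S n ∈ slabSites d (S n).L

open Classical in
/-- The glued environment `ω(z) = W_{n(z)}(z - Y_{n(z)})`, where `n(z)` is the unique `n` such that
`z` belongs to the `n`-th glued slab. (Almost surely there is a unique `n`; otherwise the
placeholder is used.) -/
def glueEnv (S : ℤ → Slab d) : Env d := fun z =>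
  if h : ∃! n : ℤ, InSlab S z n
  then (S h.choose).W (z - gluePoint S h.choose) else defaultLaw d

/-- The glued path `𝒯 = ⋃ n, (Y n + K_n [0, u_n])`, a set of sites. -/
def gluePath {d : ℕ} (S : ℤ → Slab d) : Set (Lattice d) :=
  ⋃ n : ℤ, {z | ∃ t ≤ (S n).u, z = gluePoint S n + (S n).K t}

/-- The joint law `μ` of the glued environment and the backward path, when the slabs
`(S_n)_{n ∈ ℤ}` are i.i.d. with law `λ`. -/
def backwardPathLaw (Q : Measure (StepLaw d)) : Measure (Env d × Set (Lattice d)) :=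
  (Measure.infinitePi fun _ : ℤ => slabLaw Q).map fun S => (glueEnv S, gluePath S)

/-- The law `μ̃`: the marginal distribution of the environment under `μ`. -/
def backwardEnvLaw (Q : Measure (StepLaw d)) : Measure (Env d) :=
  (backwardPathLaw Q).map Prod.fst

/-! ### The laws above are probability measures -/

theorem measurable_slab {d : ℕ} :
    Measurable (fun S : Slab d => (S.L, S.W, S.u, S.K)) := comap_measurable _

theorem measurable_level : Measurable (level (d := d)) := measurable_pi_apply _

theorem measurableSet_transientPaths : MeasurableSet (transientPaths d) := by
  have h : transientPaths d = ⋂ b : ℤ, ⋃ N : ℕ, ⋂ n : ℕ, ⋂ _ : N ≤ n,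
      {X : Path d | b ≤ level (X n)} := by
    ext X
    simp [transientPaths, tendsto_atTop, eventually_atTop]
  rw [h]
  exact MeasurableSet.iInter fun b => MeasurableSet.iUnion fun N => MeasurableSet.iInter fun n =>
    MeasurableSet.iInter fun _ => measurableSet_le measurable_const
      (measurable_level.comp (measurable_pi_apply n))

theorem measurableSet_isRegenerationTime (t : ℕ) :
    MeasurableSet {X : Path d | IsRegenerationTime X t} := by
  have hl : ∀ s t : ℕ, MeasurableSet {X : Path d | level (X s) < level (X t)} := fun s t =>
    measurableSet_lt (measurable_level.comp (measurable_pi_apply s))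
      (measurable_level.comp (measurable_pi_apply t))
  have h : {X : Path d | IsRegenerationTime X t} =
      (⋂ s : ℕ, ⋂ _ : s < t, {X : Path d | level (X s) < level (X t)}) ∩
      ⋂ s : ℕ, ⋂ _ : t < s, {X : Path d | level (X t) < level (X s)} := by
    ext X
    simp [IsRegenerationTime]
  rw [h]
  exact (MeasurableSet.iInter fun s => MeasurableSet.iInter fun _ => hl s t).inter
    (MeasurableSet.iInter fun s => MeasurableSet.iInter fun _ => hl t s)

theorem measurable_sInf_nat {α : Type*} [MeasurableSpace α] {p : α → ℕ → Prop}
    (hp : ∀ k, MeasurableSet {a | p a k}) : Measurable fun a => sInf {k | p a k} := by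
  refine measurable_of_Iio fun n => ?_
  have h : (fun a => sInf {k | p a k}) ⁻¹' Set.Iio n =
      (⋃ k : ℕ, ⋃ _ : k < n, {a | p a k}) ∪ {a | 0 < n ∧ ∀ k, ¬ p a k} := by
    ext a
    simp only [Set.mem_preimage, Set.mem_Iio, Set.mem_union, Set.mem_iUnion, Set.mem_ofPred_eq,
      exists_prop]
    constructor
    · intro ha
      by_cases hk : ∃ k, p a k
      · exact Or.inl ⟨_, ha, Nat.sInf_mem (s := {k | p a k}) hk⟩
      · exact Or.inr ⟨by omega, fun k hpk => hk ⟨k, hpk⟩⟩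
    · rintro (⟨k, hk, hpk⟩ | ⟨hn, hk⟩)
      · exact (Nat.sInf_le (s := {k | p a k}) hpk).trans_lt hk
      · have : {k | p a k} = ∅ := Set.eq_empty_of_forall_notMem hk
        rw [this]
        simpa using hn
  rw [h]
  refine (MeasurableSet.iUnion fun k => MeasurableSet.iUnion fun _ => hp k).union ?_
  have h2 : {a | 0 < n ∧ ∀ k, ¬ p a k} = {_a : α | 0 < n} ∩ ⋂ k, {a | p a k}ᶜ := by
    ext a
    simp
  rw [h2]
  exact (MeasurableSet.const _).inter (MeasurableSet.iInter fun k => (hp k).compl)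

theorem measurable_regTime (n : ℕ) : Measurable fun X : Path d => regTime X n := by
  induction n using Nat.strong_induction_on with
  | _ n ih =>
    simp only [regTime] at ih ⊢
    simp_rw [Nat.nth_eq_sInf _ n]
    refine measurable_sInf_nat fun t => ?_
    have h : {X : Path d | IsRegenerationTime X t ∧
          ∀ k < n, Nat.nth (IsRegenerationTime X) k < t} =
        {X : Path d | IsRegenerationTime X t} ∩
        ⋂ k : ℕ, ⋂ _ : k < n, {X : Path d | Nat.nth (IsRegenerationTime X) k < t} := by
      ext X
      simp
    rw [h]
    exact (measurableSet_isRegenerationTime t).inter (MeasurableSet.iInter fun k =>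
      MeasurableSet.iInter fun hk => measurableSet_lt (ih k hk) measurable_const)

theorem measurable_eval_countable {α ι β : Type*} [MeasurableSpace α] [MeasurableSpace ι]
    [MeasurableSpace β] [Countable ι] [MeasurableSingletonClass ι] {f : α → ι → β} {g : α → ι}
    (hf : Measurable f) (hg : Measurable g) : Measurable fun a => f a (g a) :=
  (measurable_from_prod_countable_left (f := fun q : (ι → β) × ι => q.1 q.2)
    fun i => measurable_pi_apply i).comp (hf.prodMk hg)

theorem measurableSet_slabSites {α : Type*} [MeasurableSpace α] {L : α → ℤ} {z : α → Lattice d}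
    (hL : Measurable L) (hz : Measurable z) : MeasurableSet {a | z a ∈ slabSites d (L a)} :=
  (measurableSet_le measurable_const (measurable_level.comp hz)).inter
    (measurableSet_lt (measurable_level.comp hz) hL)

theorem measurable_firstSlab :
    Measurable fun p : Env d × Path d => firstSlab p.1 p.2 := by
  have hr : ∀ n, Measurable fun p : Env d × Path d => regTime p.2 n := fun n =>
    (measurable_regTime n).comp measurable_snd
  have hX : ∀ {g : Env d × Path d → ℕ}, Measurable g →
      Measurable fun p : Env d × Path d => p.2 (g p) :=
    fun hg => measurable_eval_countable measurable_snd hg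
  have hL : Measurable fun p : Env d × Path d =>
      level (p.2 (regTime p.2 1)) - level (p.2 (regTime p.2 0)) :=
    (measurable_level.comp (hX (hr 1))).sub (measurable_level.comp (hX (hr 0)))
  refine measurable_comap_iff.2 (hL.prodMk (Measurable.prodMk ?_ (Measurable.prodMk ?_ ?_)))
  · refine measurable_pi_lambda _ fun z => Measurable.ite ?_ ?_ measurable_const
    · exact measurableSet_slabSites hL measurable_const
    · exact measurable_eval_countable measurable_fst (measurable_const.add (hX (hr 0)))
  · exact (hr 1).sub (hr 0)
  · refine measurable_pi_lambda _ fun t => (hX ?_).sub (hX (hr 0))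
    exact (hr 0).add (measurable_const.min ((hr 1).sub (hr 0)))

theorem measurable_gluePoint {d : ℕ} (n : ℤ) :
    Measurable fun S : ℤ → Slab d => gluePoint S n := by
  have hK : ∀ m : ℤ, Measurable fun S : ℤ → Slab d => (S m).K (S m).u := fun m => by
    have h := measurable_slab.comp (measurable_pi_apply (X := fun _ : ℤ => Slab d) m)
    exact measurable_eval_countable h.snd.snd.snd h.snd.snd.fst
  rcases n with n | n
  · exact Finset.measurable_sum _ fun k _ => hK k
  · have h : Measurable fun S : ℤ → Slab d =>
        ∑ k ∈ range (n + 1), (S (-(k + 1))).K (S (-(k + 1))).u :=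
      Finset.measurable_sum _ fun k _ => hK (-(k + 1))
    exact h.neg

theorem measurable_glue :
    Measurable fun S : ℤ → Slab d => (glueEnv S, gluePath S) := by
  have hS : ∀ n : ℤ, Measurable fun S : ℤ → Slab d => ((S n).L, (S n).W, (S n).u, (S n).K) :=
    fun n => measurable_slab.comp (measurable_pi_apply (X := fun _ : ℤ => Slab d) n)
  have hin : ∀ (z : Lattice d) (n : ℤ), MeasurableSet {S : ℤ → Slab d | InSlab S z n} :=
    fun z n => measurableSet_slabSites (hS n).fst (measurable_const.sub (measurable_gluePoint n))
  refine Measurable.prodMk (measurable_pi_lambda _ fun z => ?_) (measurable_set_iff.2 fun z => ?_)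
  · have hu : ∀ n : ℤ, MeasurableSet
        {S : ℤ → Slab d | InSlab S z n ∧ ∀ m, InSlab S z m → m = n} := fun n => by
      have h : {S : ℤ → Slab d | InSlab S z n ∧ ∀ m, InSlab S z m → m = n} =
          {S | InSlab S z n} ∩ ⋂ m : ℤ, ⋂ _ : m ≠ n, {S | InSlab S z m}ᶜ := by
        ext S
        simp only [Set.mem_ofPred_eq, Set.mem_inter_iff, Set.mem_iInter, Set.mem_compl_iff]
        exact and_congr_right fun _ => forall_congr' fun m =>
          ⟨fun h h1 h2 => h1 (h h2), fun h h2 => by_contra fun h1 => h h1 h2⟩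
      rw [h]
      exact (hin z n).inter
        (MeasurableSet.iInter fun m => MeasurableSet.iInter fun _ => (hin z m).compl)
    have hW : ∀ n : ℤ, Measurable fun S : ℤ → Slab d => (S n).W (z - gluePoint S n) := fun n =>
      measurable_eval_countable (hS n).snd.fst (measurable_const.sub (measurable_gluePoint n))
    intro B hB
    have h : (fun S : ℤ → Slab d => glueEnv S z) ⁻¹' B =
        (⋃ n : ℤ, {S : ℤ → Slab d | InSlab S z n ∧ ∀ m, InSlab S z m → m = n} ∩
          (fun S : ℤ → Slab d => (S n).W (z - gluePoint S n)) ⁻¹' B) ∪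
        ((⋃ n : ℤ, {S : ℤ → Slab d | InSlab S z n ∧ ∀ m, InSlab S z m → m = n})ᶜ ∩
          {_S | defaultLaw d ∈ B}) := by
      ext S
      simp only [Set.mem_preimage, Set.mem_union, Set.mem_iUnion, Set.mem_inter_iff,
        Set.mem_ofPred_eq, Set.mem_compl_iff]
      by_cases hex : ∃! n : ℤ, InSlab S z n
      · have h1 : glueEnv S z = (S hex.choose).W (z - gluePoint S hex.choose) := by
          simp only [glueEnv, dif_pos hex]
        rw [h1]
        constructor
        · exact fun hm => Or.inl ⟨hex.choose, hex.choose_spec, hm⟩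
        · rintro (⟨n, hn, hm⟩ | ⟨hn, -⟩)
          · rwa [hn.2 _ hex.choose_spec.1]
          · exact (hn hex).elim
      · have h1 : glueEnv S z = defaultLaw d := by simp only [glueEnv, dif_neg hex]
        rw [h1]
        constructor
        · exact fun hm => Or.inr ⟨hex, hm⟩
        · rintro (⟨n, hn, -⟩ | ⟨-, hm⟩)
          · exact (hex ⟨n, hn⟩).elim
          · exact hm
    rw [h]
    exact (MeasurableSet.iUnion fun n => (hu n).inter (hW n hB)).union
      ((MeasurableSet.iUnion hu).compl.inter (MeasurableSet.const _))
  · refine measurableSet_setOfPred.1 ?_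
    have h : {S : ℤ → Slab d | z ∈ gluePath S} =
        ⋃ n : ℤ, ⋃ t : ℕ, {S : ℤ → Slab d | t ≤ (S n).u} ∩
          {S : ℤ → Slab d | z = gluePoint S n + (S n).K t} := by
      ext S
      simp [gluePath]
    rw [h]
    refine MeasurableSet.iUnion fun n => MeasurableSet.iUnion fun t =>
      (measurableSet_le measurable_const (hS n).snd.snd.fst).inter
      (measurableSet_eq_fun measurable_const ((measurable_gluePoint n).add ?_))
    exact (measurable_pi_apply t).comp (hS n).snd.snd.snd

theorem isProbabilityMeasure_slabLaw (Q : Measure (StepLaw d)) [IsProbabilityMeasure Q]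
    (hA : 0 < jointLaw (envLaw Q) 0 (Prod.snd ⁻¹' transientPaths d)) :
    IsProbabilityMeasure (slabLaw Q) := by
  have : IsProbabilityMeasure (envLaw Q) := by unfold envLaw; infer_instance
  have : IsProbabilityMeasure (jointLaw (envLaw Q) 0) := by unfold jointLaw; infer_instance
  have := cond_isProbabilityMeasure hA.ne'
  exact Measure.isProbabilityMeasure_map measurable_firstSlab.aemeasurable

theorem isProbabilityMeasure_backwardEnvLaw (Q : Measure (StepLaw d)) [IsProbabilityMeasure Q]
    (hA : 0 < jointLaw (envLaw Q) 0 (Prod.snd ⁻¹' transientPaths d)) :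
    IsProbabilityMeasure (backwardEnvLaw Q) := by
  have := isProbabilityMeasure_slabLaw Q hA
  have : IsProbabilityMeasure (backwardPathLaw Q) :=
    Measure.isProbabilityMeasure_map measurable_glue.aemeasurable
  exact Measure.isProbabilityMeasure_map measurable_fst.aemeasurable

end RWRE

end

/-! A walk that escapes to infinity sees, far along its trajectory, an environment from which escape
is almost certain; the glued environment is what it sees in the limit.

Let `upTransient` be the event that the walk is transient and never returns to its initial level. It
has positive probability (`jointLaw_upTransient_pos`). Under the conditioning on it, with the
environment below level 0 erased (`upLaw`), the successive regeneration slabs are i.i.d. with law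
`slabLaw` (`slabLaw_eq_map_upLaw`, `upLaw_slabOf_nextPair`, `upLaw_map_slabSeq`). The erasure
matters: the environment below a regeneration point has been explored, while the one above is fresh.
The source of this is `jointLaw_regeneration`: at a strict record of the level, the past reads the
environment strictly below that level and a non-returning future reads it only from that level on.

By Lévy's zero-one law, in a fixed environment and on the event that the walk escapes inside the
upper half-space, the quenched probability of such an escape from the current position tends to 1
(`ae_tendsto_quenchedLaw_upperTransient`). Gluing the slabs of the walk restores the environment on
the upper half-space, so along the ends of the slabs this says that `escapeProb N` tends to 1, and
by dominated convergence so does its mean under i.i.d. slabs (`tendsto_lintegral_escapeProb`).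

In a doubly infinite i.i.d. sequence, the slabs from index `-N` on have the law of a one-sided
sequence, and the origin is the bottom of the slab with index `N` among them. Hence the mean of
`escapeProb N` is at most the averaged probability of transience from 0, for every `N`. That
probability is therefore 1 (`ae_glueEnv_transient_zero`). Ellipticity then carries the result from 0
to every starting site (`ae_glueEnv_transient`). -/

noncomputable section

namespace RWRE

/-! ### Paths and cylinders -/

section Paths

variable {d : ℕ}

/-- The cylinder of the trajectories which agree with `γ` up to time `n`. -/
def cyl (n : ℕ) (γ : Path d) : Set (Path d) := {X | ∀ i ≤ n, X i = γ i}

/-- The trajectory after time `n`. -/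
def shiftPath (n : ℕ) (X : Path d) : Path d := fun i => X (n + i)

/-- The spatial translate of a trajectory. -/
def subPath (v : Lattice d) (X : Path d) : Path d := fun i => X i - v

/-- The environment seen from `v`. -/
def shiftEnv (v : Lattice d) (ω : Env d) : Env d := fun x => ω (x + v)

theorem measurable_shiftPath (n : ℕ) : Measurable (shiftPath (d := d) n) :=
  measurable_pi_lambda _ fun i => measurable_pi_apply (n + i)

theorem measurable_subPath (v : Lattice d) : Measurable (subPath (d := d) v) :=
  measurable_pi_lambda _ fun i => (measurable_pi_apply (X := fun _ : ℕ => Lattice d) i).sub_const v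

theorem measurable_shiftEnv (v : Lattice d) : Measurable (shiftEnv (d := d) v) :=
  measurable_pi_lambda _ fun x => measurable_pi_apply (x + v)

theorem measurableSet_cyl (n : ℕ) (γ : Path d) : MeasurableSet (cyl n γ) := by
  have h : cyl n γ = ⋂ i : ℕ, ⋂ _ : i ≤ n, (fun X : Path d => X i) ⁻¹' {γ i} := by
    ext X; simp [cyl]
  rw [h]
  exact MeasurableSet.iInter fun i => MeasurableSet.iInter fun _ =>
    measurable_pi_apply i (measurableSet_singleton _)

theorem mem_cyl_self (n : ℕ) (γ : Path d) : γ ∈ cyl n γ := fun _ _ => rfl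

theorem cyl_congr {n : ℕ} {γ γ' : Path d} (h : ∀ i ≤ n, γ i = γ' i) : cyl n γ = cyl n γ' := by
  ext X
  exact forall₂_congr fun i hi => by rw [h i hi]

/-- The initial part of a trajectory, up to time `n`. -/
def initPath (n : ℕ) (X : Path d) : Iic n → Lattice d := fun i => X i

theorem measurable_initPath (n : ℕ) : Measurable (initPath (d := d) n) :=
  measurable_pi_lambda _ fun i => measurable_pi_apply (i : ℕ)

/-- The trajectory which follows the finite path `h` and then stays at its end. -/
def extendPath {n : ℕ} (h : Iic n → Lattice d) : Path d :=
  fun i => h ⟨min i n, mem_Iic.2 (min_le_right _ _)⟩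

theorem extendPath_apply {n : ℕ} (h : Iic n → Lattice d) {i : ℕ} (hi : i ≤ n) :
    extendPath h i = h ⟨i, mem_Iic.2 hi⟩ := by
  simp [extendPath, min_eq_left hi]

theorem mem_cyl_extendPath_iff {n : ℕ} {h : Iic n → Lattice d} {X : Path d} :
    X ∈ cyl n (extendPath h) ↔ initPath n X = h := by
  constructor
  · intro hX
    funext i
    have := hX i (mem_Iic.1 i.2)
    rw [extendPath_apply h (mem_Iic.1 i.2)] at this
    exact this
  · rintro rfl i hi
    rw [extendPath_apply _ hi]
    rfl

theorem cyl_eq_preimage (n : ℕ) (γ : Path d) :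
    cyl n γ = initPath n ⁻¹' {initPath n γ} := by
  ext X
  rw [cyl_congr (γ' := extendPath (initPath n γ))
    fun i hi => (extendPath_apply (initPath n γ) hi).symm, mem_cyl_extendPath_iff]
  rfl

theorem pairwise_disjoint_cyl (n : ℕ) :
    Pairwise (Function.onFun Disjoint fun h : Iic n → Lattice d => cyl n (extendPath h)) := by
  intro h h' hne
  refine Set.disjoint_left.2 fun X hX hX' => hne ?_
  rw [← mem_cyl_extendPath_iff.1 hX, ← mem_cyl_extendPath_iff.1 hX']

/-- The measure of a set of trajectories is the sum over the initial paths of length `n`. -/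
theorem measure_eq_tsum_cyl (μ : Measure (Path d)) (n : ℕ) {B : Set (Path d)}
    (hB : MeasurableSet B) :
    μ B = ∑' h : Iic n → Lattice d, μ (B ∩ cyl n (extendPath h)) := by
  rw [← measure_iUnion (fun h h' hne => (pairwise_disjoint_cyl n hne).mono Set.inter_subset_right
    Set.inter_subset_right) fun h => hB.inter (measurableSet_cyl _ _)]
  congr 1
  ext X
  simp only [Set.mem_iUnion, Set.mem_inter_iff, mem_cyl_extendPath_iff]
  simp

/-- Finite measures on trajectories are determined by the cylinders. -/
theorem pathMeasure_ext {μ ν : Measure (Path d)} [IsFiniteMeasure μ] [IsFiniteMeasure ν]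
    (h : ∀ n γ, μ (cyl n γ) = ν (cyl n γ)) : μ = ν := by
  have h1 : ∀ n, μ.map (initPath n) = ν.map (initPath n) := fun n => by
    refine Measure.ext_of_singleton fun x => ?_
    rw [Measure.map_apply (measurable_initPath n) (measurableSet_singleton x),
      Measure.map_apply (measurable_initPath n) (measurableSet_singleton x)]
    have := h n (extendPath x)
    rw [cyl_eq_preimage] at this
    rwa [mem_cyl_extendPath_iff.1 (mem_cyl_self n (extendPath x))] at this
  have key : ∀ I : Finset ℕ, ν.map I.restrict = μ.map I.restrict := fun I => by
    have hm : ∀ ρ : Measure (Path d), ρ.map I.restrict =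
        (ρ.map (initPath (I.sup id))).map
          (restrict₂ (π := fun _ => Lattice d) I.subset_Iic_sup_id) := fun ρ => by
      rw [Measure.map_map (measurable_restrict₂ (X := fun _ => Lattice d) _) (measurable_initPath _)]
      rfl
    rw [hm μ, hm ν, h1]
  exact IsProjectiveLimit.unique (P := fun I => μ.map I.restrict) (fun I => rfl) key

end Paths

/-! ### The quenched law -/

section Quenched

variable {d : ℕ}

/-- The law of the position after a jump from `x`. -/
def jump (ω : Env d) (x : Lattice d) : Measure (Lattice d) :=
  Measure.map (fun e : Step d => x + (e : Lattice d)) (ω x).toMeasure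

/-- The composition of kernels is a sum over all histories up to time `n`, and only the history of
`γ` itself can be continued to the prescribed path. This is the recursion behind the product formula
for cylinders. -/
theorem partialTraj_singleton_succ (ω : Env d) (z : Lattice d) (n : ℕ) (γ : Path d) :
    Kernel.partialTraj (X := fun _ => Lattice d) (stepKernel ω) 0 (n + 1) (fun _ => z)
        {initPath (n + 1) γ} =
      jump ω (γ n) {γ (n + 1)} *
      Kernel.partialTraj (X := fun _ => Lattice d) (stepKernel ω) 0 n (fun _ => z)
        {initPath n γ} := by
  rw [Kernel.partialTraj_succ_eq_comp (Nat.zero_le n), Kernel.comp_apply' _ _ _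
    (measurableSet_singleton _), lintegral_countable']
  have h2 : ∀ h : Iic n → Lattice d,
      Kernel.partialTraj (X := fun _ => Lattice d) (stepKernel ω) n (n + 1) h {initPath (n + 1) γ} =
      stepKernel ω n h
        ((fun x => IicProdIoc (X := fun _ => Lattice d) n (n + 1)
          (h, MeasurableEquiv.piSingleton (X := fun _ => Lattice d) n x)) ⁻¹'
            {initPath (n + 1) γ}) := by
    intro h
    have hp : MeasurableSet (IicProdIoc (X := fun _ => Lattice d) n (n + 1) ⁻¹'
        {initPath (n + 1) γ}) := measurable_IicProdIoc (measurableSet_singleton _)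
    rw [Kernel.partialTraj_succ_self, Kernel.map_apply' _ (by fun_prop) _
        (measurableSet_singleton _),
      Kernel.prod_apply, Kernel.id_apply, Measure.prod_apply hp,
      lintegral_dirac, Kernel.map_apply' _ (by fun_prop) _ (measurable_prodMk_left hp)]
    rfl
  have h3 : ∀ (h : Iic n → Lattice d) (x : Lattice d),
      IicProdIoc (X := fun _ => Lattice d) n (n + 1)
          (h, MeasurableEquiv.piSingleton (X := fun _ => Lattice d) n x) = initPath (n + 1) γ ↔
        h = initPath n γ ∧ x = γ (n + 1) := by
    intro h x
    constructor
    · intro hh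
      constructor
      · funext i
        have := congrFun hh ⟨i, mem_Iic.2 ((mem_Iic.1 i.2).trans (Nat.le_succ n))⟩
        simp only [IicProdIoc, mem_Iic.1 i.2, dite_true] at this
        exact this
      · have := congrFun hh ⟨n + 1, mem_Iic.2 le_rfl⟩
        simpa [IicProdIoc, MeasurableEquiv.piSingleton, initPath] using this
    · rintro ⟨rfl, rfl⟩
      funext ⟨i, hi⟩
      rcases (mem_Iic.1 hi).lt_or_eq with h | h
      · simp [IicProdIoc, Nat.lt_succ_iff.1 h, initPath]
      · subst h
        simp [IicProdIoc, MeasurableEquiv.piSingleton, initPath]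
  rw [tsum_eq_single (initPath n γ)]
  · rw [h2]
    congr 1
    have : (fun x => IicProdIoc (X := fun _ => Lattice d) n (n + 1)
          (initPath n γ, MeasurableEquiv.piSingleton (X := fun _ => Lattice d) n x)) ⁻¹'
            {initPath (n + 1) γ} = {γ (n + 1)} := by
      ext x
      simpa using h3 (initPath n γ) x
    rw [this]
    rfl
  · intro h hh
    rw [h2]
    have : (fun x => IicProdIoc (X := fun _ => Lattice d) n (n + 1)
          (h, MeasurableEquiv.piSingleton (X := fun _ => Lattice d) n x)) ⁻¹'
            {initPath (n + 1) γ} = ∅ := by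
      ext x
      simpa using fun hx => hh ((h3 h x).1 hx).1
    rw [this]
    simp

open Classical in
/-- The quenched probability of a cylinder is the product of the jump probabilities. -/
theorem quenchedLaw_cyl (ω : Env d) (z : Lattice d) (n : ℕ) (γ : Path d) :
    quenchedLaw ω z (cyl n γ) =
      if γ 0 = z then ∏ i ∈ range n, jump ω (γ i) {γ (i + 1)} else 0 := by
  have h0 : quenchedLaw ω z (cyl n γ) = Kernel.partialTraj (X := fun _ => Lattice d)
      (stepKernel ω) 0 n (fun _ => z) {initPath n γ} := by
    rw [cyl_eq_preimage, ← Kernel.traj_map_frestrictLe_apply,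
      Measure.map_apply (by fun_prop) (measurableSet_singleton _)]
    rfl
  rw [h0]
  clear h0
  induction n with
  | zero =>
    rw [Kernel.partialTraj_self, Kernel.id_apply, Measure.dirac_apply' _ (measurableSet_singleton _)]
    have : ((fun _ => z) ∈ ({initPath 0 γ} : Set (Iic 0 → Lattice d))) ↔ γ 0 = z := by
      rw [Set.mem_singleton_iff]
      constructor
      · exact fun h => (congrFun h ⟨0, mem_Iic.2 le_rfl⟩).symm
      · rintro rfl
        funext ⟨i, hi⟩
        have : i = 0 := by simpa using hi
        subst this
        rfl
    by_cases h : γ 0 = z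
    · rw [Set.indicator_of_mem (this.2 h)]; simp [h]
    · rw [Set.indicator_of_notMem (mt this.1 h)]; simp [h]
  | succ n ih =>
    rw [partialTraj_singleton_succ, ih]
    split_ifs
    · rw [prod_range_succ, mul_comm]
    · simp

theorem quenchedLaw_cyl_of_eq (ω : Env d) (n : ℕ) (γ : Path d) :
    quenchedLaw ω (γ 0) (cyl n γ) = ∏ i ∈ range n, jump ω (γ i) {γ (i + 1)} := by
  classical
  rw [quenchedLaw_cyl, if_pos rfl]

theorem quenchedLaw_cyl_of_ne (ω : Env d) {z : Lattice d} (n : ℕ) {γ : Path d} (h : γ 0 ≠ z) :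
    quenchedLaw ω z (cyl n γ) = 0 := by
  classical
  rw [quenchedLaw_cyl, if_neg h]

theorem quenchedLaw_start (ω : Env d) (z : Lattice d) : ∀ᵐ X ∂quenchedLaw ω z, X 0 = z := by
  have h := quenchedLaw_cyl_of_eq ω 0 (fun _ => z)
  have h2 : cyl 0 (fun _ => z) = {X : Path d | X 0 = z} := by
    ext X
    simp [cyl]
  rw [h2, range_zero, prod_empty] at h
  exact (prob_compl_eq_zero_iff
    (measurable_pi_apply (X := fun _ : ℕ => Lattice d) 0 (measurableSet_singleton z))).2 h

/-- The Markov property at a deterministic time. -/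
theorem quenchedLaw_markov (ω : Env d) (z : Lattice d) (n : ℕ) (γ : Path d) {B : Set (Path d)}
    (hB : MeasurableSet B) :
    quenchedLaw ω z (cyl n γ ∩ shiftPath n ⁻¹' B) =
      quenchedLaw ω z (cyl n γ) * quenchedLaw ω (γ n) B := by
  have hc : quenchedLaw ω z (cyl n γ) ≠ ⊤ := measure_ne_top _ _
  have : IsFiniteMeasure (quenchedLaw ω z (cyl n γ) • quenchedLaw ω (γ n)) :=
    Measure.smul_finite _ hc
  -- As an identity of finite measures in `B`, the Markov property need only be checked when `B` is
  -- a cylinder, where both sides are products of jump probabilities.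
  have key : ((quenchedLaw ω z).restrict (cyl n γ)).map (shiftPath n) =
      quenchedLaw ω z (cyl n γ) • quenchedLaw ω (γ n) := by
    refine pathMeasure_ext fun m η => ?_
    rw [Measure.map_apply (measurable_shiftPath n) (measurableSet_cyl m η),
      Measure.restrict_apply (measurable_shiftPath n (measurableSet_cyl m η)),
      Measure.smul_apply, smul_eq_mul]
    by_cases hη : η 0 = γ n
    -- The concatenation of `γ` and `η`, consistent because `η` starts where `γ` is at time `n`.
    · let ζ : Path d := fun i => if i ≤ n then γ i else η (i - n)
      have hζ1 : ∀ i ≤ n, ζ i = γ i := fun i hi => by simp [ζ, hi]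
      have hζ2 : ∀ i, ζ (n + i) = η i := fun i => by
        rcases Nat.eq_zero_or_pos i with rfl | hi
        · simp [ζ, hη]
        · have : ¬ n + i ≤ n := by omega
          simp [ζ, this]
      have h1 : shiftPath n ⁻¹' cyl m η ∩ cyl n γ = cyl (n + m) ζ := by
        ext X
        constructor
        · rintro ⟨h1, h2⟩ i hi
          by_cases h : i ≤ n
          · rw [h2 i h, hζ1 i h]
          · obtain ⟨j, rfl⟩ := Nat.exists_eq_add_of_le (not_le.1 h).le
            rw [hζ2 j]
            exact h1 j (by omega)
        · intro h
          refine ⟨fun i hi => ?_, fun i hi => ?_⟩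
          · rw [← hζ2 i]
            exact h (n + i) (by omega)
          · rw [← hζ1 i hi]
            exact h i (by omega)
      rw [h1]
      by_cases hz : γ 0 = z
      · subst hz
        have h2 := quenchedLaw_cyl_of_eq ω (n + m) ζ
        rw [hζ1 0 (Nat.zero_le n)] at h2
        have h3 := quenchedLaw_cyl_of_eq ω m η
        rw [hη] at h3
        rw [h2, h3, quenchedLaw_cyl_of_eq, prod_range_add]
        congr 1
        · refine prod_congr rfl fun i hi => ?_
          rw [hζ1 i (mem_range.1 hi).le, hζ1 (i + 1) (mem_range.1 hi)]
        · refine prod_congr rfl fun i _ => ?_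
          rw [hζ2 i, add_assoc, hζ2 (i + 1)]
      · rw [quenchedLaw_cyl_of_ne ω _ hz, quenchedLaw_cyl_of_ne ω _ (γ := ζ)
          (by rwa [hζ1 0 (Nat.zero_le n)]), zero_mul]
    · rw [quenchedLaw_cyl_of_ne ω _ hη, mul_zero]
      have : shiftPath n ⁻¹' cyl m η ∩ cyl n γ = ∅ := by
        refine Set.eq_empty_of_forall_notMem fun X hX => hη ?_
        rw [← hX.1 0 (Nat.zero_le m), ← hX.2 n le_rfl]
        rfl
      rw [this, measure_empty]
  have := congrArg (fun μ => μ B) key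
  simp only [Measure.smul_apply, smul_eq_mul] at this
  rw [← this, Measure.map_apply (measurable_shiftPath n) hB,
    Measure.restrict_apply (measurable_shiftPath n hB), Set.inter_comm]

theorem jump_shiftEnv (ω : Env d) (v x y : Lattice d) :
    jump (shiftEnv v ω) x {y} = jump ω (x + v) {y + v} := by
  rw [jump, jump, Measure.map_apply Measurable.of_discrete (measurableSet_singleton _),
    Measure.map_apply Measurable.of_discrete (measurableSet_singleton _)]
  congr 1
  ext e
  simp only [Set.mem_preimage, Set.mem_singleton_iff]
  rw [add_right_comm, add_left_inj]

/-- Translation of the environment amounts to translation of the walk. -/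
theorem quenchedLaw_shiftEnv (ω : Env d) (v z : Lattice d) :
    quenchedLaw (shiftEnv v ω) z = (quenchedLaw ω (z + v)).map (subPath v) := by
  have : IsProbabilityMeasure ((quenchedLaw ω (z + v)).map (subPath v)) :=
    Measure.isProbabilityMeasure_map (measurable_subPath v).aemeasurable
  refine pathMeasure_ext fun n γ => ?_
  rw [Measure.map_apply (measurable_subPath v) (measurableSet_cyl n γ)]
  have h1 : subPath v ⁻¹' cyl n γ = cyl n fun i => γ i + v := by
    ext X
    exact forall₂_congr fun i _ => sub_eq_iff_eq_add
  classical
  rw [h1, quenchedLaw_cyl, quenchedLaw_cyl]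
  simp only [add_left_inj, jump_shiftEnv]

theorem jump_congr {ω ω' : Env d} {x : Lattice d} (h : ω x = ω' x) : jump ω x = jump ω' x := by
  rw [jump, jump, h]

/-- A cylinder only depends on the environment at the sites visited before its last time. -/
theorem quenchedLaw_cyl_congr {ω ω' : Env d} (z : Lattice d) (n : ℕ) (γ : Path d)
    (h : ∀ i < n, ω (γ i) = ω' (γ i)) :
    quenchedLaw ω z (cyl n γ) = quenchedLaw ω' z (cyl n γ) := by
  classical
  rw [quenchedLaw_cyl, quenchedLaw_cyl]
  congr 1
  exact prod_congr rfl fun i hi => by rw [jump_congr (h i (mem_range.1 hi))]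

/-- The walk, as long as it stays in a set of sites, only depends on the environment there. -/
theorem quenchedLaw_inter_congr {ω ω' : Env d} (V : Set (Lattice d)) (h : ∀ x ∈ V, ω x = ω' x)
    (z : Lattice d) {B : Set (Path d)} (hB : MeasurableSet B) (hBV : ∀ X ∈ B, ∀ i, X i ∈ V) :
    quenchedLaw ω z B = quenchedLaw ω' z B := by
  set HN : ℕ → Set (Path d) := fun n => {X | ∀ i ≤ n, X i ∈ V} with hHN
  have hHNm : ∀ n, MeasurableSet (HN n) := fun n => by
    have h : HN n = ⋂ i : ℕ, ⋂ _ : i ≤ n, (fun X : Path d => X i) ⁻¹' V := by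
      ext X; simp [HN]
    rw [h]
    exact MeasurableSet.iInter fun i => MeasurableSet.iInter fun _ =>
      measurable_pi_apply i MeasurableSet.of_discrete
  set H : Set (Path d) := ⋂ n, HN n with hH
  have hHm : MeasurableSet H := MeasurableSet.iInter hHNm
  have hanti : Antitone HN := fun m n hmn X hX i hi => hX i (hi.trans hmn)
  -- Up to the finite time `m`, the event is a disjoint union of cylinders of length `m` whose paths
  -- stay in `V`, and these have the same probability in both environments. Letting `m` tend to
  -- infinity gives equality of the measures restricted to `H`.
  have h1 : ∀ (n m : ℕ) (γ : Path d), n ≤ m →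
      quenchedLaw ω z (cyl n γ ∩ HN m) = quenchedLaw ω' z (cyl n γ ∩ HN m) := by
    intro n m γ hnm
    rw [measure_eq_tsum_cyl _ m ((measurableSet_cyl n γ).inter (hHNm m)),
      measure_eq_tsum_cyl (quenchedLaw ω' z) m ((measurableSet_cyl n γ).inter (hHNm m))]
    refine tsum_congr fun η => ?_
    by_cases hη : extendPath η ∈ cyl n γ ∩ HN m
    · have : cyl n γ ∩ HN m ∩ cyl m (extendPath η) = cyl m (extendPath η) := by
        refine Set.inter_eq_right.2 fun X hX => ⟨fun i hi => ?_, fun i hi => ?_⟩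
        · rw [hX i (hi.trans hnm), hη.1 i hi]
        · rw [hX i hi]; exact hη.2 i hi
      rw [this]
      exact quenchedLaw_cyl_congr _ _ _ fun i hi => h _ (hη.2 i hi.le)
    · have : cyl n γ ∩ HN m ∩ cyl m (extendPath η) = ∅ := by
        refine Set.eq_empty_of_forall_notMem fun X hX => hη ⟨fun i hi => ?_, fun i hi => ?_⟩
        · rw [← hX.2 i (hi.trans hnm), hX.1.1 i hi]
        · rw [← hX.2 i hi]; exact hX.1.2 i hi
      rw [this, measure_empty, measure_empty]
  have h2 : (quenchedLaw ω z).restrict H = (quenchedLaw ω' z).restrict H := by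
    refine pathMeasure_ext fun n γ => ?_
    rw [Measure.restrict_apply (measurableSet_cyl n γ),
      Measure.restrict_apply (measurableSet_cyl n γ)]
    have h3 : ∀ ρ : Measure (Path d), [IsFiniteMeasure ρ] →
        Tendsto (fun m => ρ (cyl n γ ∩ HN m)) atTop (nhds (ρ (cyl n γ ∩ H))) := by
      intro ρ _
      rw [hH, Set.inter_iInter]
      exact tendsto_measure_iInter_atTop
        (fun m => ((measurableSet_cyl n γ).inter (hHNm m)).nullMeasurableSet)
        (fun a b hab => Set.inter_subset_inter_right _ (hanti hab)) ⟨0, measure_ne_top _ _⟩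
    refine tendsto_nhds_unique (h3 _) ((h3 _).congr' ?_)
    filter_upwards [eventually_ge_atTop n] with m hm
    exact (h1 n m γ hm).symm
  have h4 : B ∩ H = B := Set.inter_eq_left.2 fun X hX =>
    Set.mem_iInter.2 fun n i _ => hBV X hX i
  have := congrArg (fun μ => μ B) h2
  simpa only [Measure.restrict_apply hB, h4] using this

/-- If a shift-invariant event is null for the walk from `z`, then it is null for the walk from
any site to which the walk can jump. -/
theorem quenchedLaw_eq_zero_of_jump {ω : Env d} {z y : Lattice d} {B : Set (Path d)}
    (hB : MeasurableSet B) (hinv : shiftPath 1 ⁻¹' B = B) (hj : jump ω z {y} ≠ 0)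
    (h0 : quenchedLaw ω z B = 0) : quenchedLaw ω y B = 0 := by
  let γ : Path d := fun i => if i = 0 then z else y
  have h1 := quenchedLaw_markov ω z 1 γ hB
  have h2 := quenchedLaw_cyl_of_eq ω 1 γ
  have h3 : γ 0 = z := by simp [γ]
  have h4 : γ 1 = y := by simp [γ]
  rw [h3, range_one, prod_singleton, h3, zero_add, h4] at h2
  rw [hinv, h2, h4, measure_mono_null Set.inter_subset_right h0] at h1
  exact (mul_eq_zero.1 h1.symm).resolve_left hj

end Quenched

/-! ### Lévy's zero-one law on trajectories -/

/-- For each `n` there are only countably many cylinders, so the null ones have a null union. -/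
theorem ae_measure_cyl_pos {d : ℕ} (κ : Measure (Path d)) :
    ∀ᵐ X ∂κ, ∀ n, 0 < κ (cyl n X) := by
  refine ae_all_iff.2 fun n => ?_
  have h : {X | ¬ 0 < κ (cyl n X)} ⊆
      ⋃ h : {h : Iic n → Lattice d // κ (cyl n (extendPath h)) = 0}, cyl n (extendPath h.1) := by
    intro X hX
    have h1 : cyl n (extendPath (initPath n X)) = cyl n X :=
      cyl_congr fun i hi => extendPath_apply _ hi
    refine Set.mem_iUnion.2 ⟨⟨initPath n X, ?_⟩, mem_cyl_extendPath_iff.2 rfl⟩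
    rw [h1]
    simpa using hX
  exact measure_mono_null h (measure_iUnion_null fun h => h.2)

/-- The filtration of the initial parts of a trajectory. -/
def initFiltration (d : ℕ) : Filtration ℕ (inferInstance : MeasurableSpace (Path d)) where
  seq n := MeasurableSpace.comap (initPath n) inferInstance
  mono' m n hmn := by
    have h : initPath (d := d) m =
        (restrict₂ (π := fun _ => Lattice d) (Iic_subset_Iic.2 hmn)) ∘ initPath n := rfl
    change MeasurableSpace.comap (initPath m) _ ≤ MeasurableSpace.comap (initPath n) _
    rw [h, ← MeasurableSpace.comap_comp]
    exact MeasurableSpace.comap_mono (measurable_restrict₂ (X := fun _ => Lattice d) _).comap_le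
  le' n := (measurable_initPath n).comap_le

theorem iSup_initFiltration (d : ℕ) :
    (⨆ n, initFiltration d n) = (inferInstance : MeasurableSpace (Path d)) := by
  refine le_antisymm (iSup_le fun n => (initFiltration d).le n) (iSup_le fun n => ?_)
  refine le_trans ?_ (le_iSup (fun n => (initFiltration d n : MeasurableSpace (Path d))) n)
  have h : (fun X : Path d => X n) =
      (fun h : Iic n → Lattice d => h ⟨n, mem_Iic.2 le_rfl⟩) ∘ initPath n := rfl
  change MeasurableSpace.comap (fun X : Path d => X n) _ ≤
    MeasurableSpace.comap (initPath n) inferInstance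
  rw [h, ← MeasurableSpace.comap_comp]
  exact MeasurableSpace.comap_mono (measurable_pi_apply _).comap_le

/-- On almost every trajectory of an event `E`, the conditional probability of `E` given the
initial part of the trajectory exceeds eventually any given number less than `1`. -/
theorem ae_lt_measureReal_inter_cyl {d : ℕ} (κ : Measure (Path d)) [IsFiniteMeasure κ]
    {E : Set (Path d)} (hE : MeasurableSet E) {c : ℝ} (hc : c < 1) :
    ∀ᵐ X ∂κ, X ∈ E → ∀ᶠ n in atTop, c * κ.real (cyl n X) < κ.real (E ∩ cyl n X) := by
  set g : Path d → ℝ := E.indicator 1 with hg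
  have hgi : Integrable g κ := (integrable_indicator_iff hE).2 (integrable_const 1).integrableOn
  have hgm : StronglyMeasurable[⨆ n, initFiltration d n] g := by
    rw [iSup_initFiltration]
    exact stronglyMeasurable_one.indicator hE
  -- The conditional expectation is a function of the initial path, hence constant on the cylinder;
  -- integrating it there gives the elementary conditional probability.
  have hcond : ∀ n X, (κ[g | initFiltration d n]) X * κ.real (cyl n X) =
      κ.real (E ∩ cyl n X) := by
    intro n X
    have hcm : MeasurableSet[initFiltration d n] (cyl n X) := by
      rw [cyl_eq_preimage]
      exact ⟨_, measurableSet_singleton _, rfl⟩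
    have h1 := setIntegral_condExp ((initFiltration d).le n) hgi hcm
    have h2 : ∀ Y ∈ cyl n X, (κ[g | initFiltration d n]) Y = (κ[g | initFiltration d n]) X := by
      intro Y hY
      obtain ⟨F, -, hF⟩ := (stronglyMeasurable_condExp (μ := κ) (f := g)
        (m := initFiltration d n)).measurable.exists_eq_measurable_comp
      have : initPath n Y = initPath n X := funext fun i => hY i (mem_Iic.1 i.2)
      rw [hF, Function.comp_apply, Function.comp_apply, this]
    rw [setIntegral_congr_fun (measurableSet_cyl n X) h2, setIntegral_const, smul_eq_mul, mul_comm,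
      hg, setIntegral_indicator hE] at h1
    rw [h1]
    simp [Set.inter_comm]
  filter_upwards [hgi.tendsto_ae_condExp hgm, ae_measure_cyl_pos κ] with X hX hpos hXE
  have hgX : g X = 1 := by simp [hg, hXE]
  rw [hgX] at hX
  filter_upwards [hX.eventually (lt_mem_nhds hc)] with n hn
  rw [← hcond n X]
  exact mul_lt_mul_of_pos_right hn (ENNReal.toReal_pos (hpos n).ne' (measure_ne_top _ _))


/-! ### The law of the environment -/

section EnvLaw

variable {d : ℕ} (Q : Measure (StepLaw d)) [IsProbabilityMeasure Q]

instance : IsProbabilityMeasure (envLaw Q) := by unfold envLaw; infer_instance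

instance (ν : Measure (Env d)) [IsProbabilityMeasure ν] (z : Lattice d) :
    IsProbabilityMeasure (jointLaw ν z) := by unfold jointLaw; infer_instance

theorem jointLaw_apply (ν : Measure (Env d)) [IsProbabilityMeasure ν] (z : Lattice d)
    {S : Set (Env d × Path d)} (hS : MeasurableSet S) :
    jointLaw ν z S = ∫⁻ ω, quenchedLaw ω z (Prod.mk ω ⁻¹' S) ∂ν := 
  Measure.compProd_apply (μ := ν) (κ := quenchedKernel z) hS

theorem measurable_quenchedLaw_section (z : Lattice d) {S : Set (Env d × Path d)}
    (hS : MeasurableSet S) : Measurable fun ω : Env d => quenchedLaw ω z (Prod.mk ω ⁻¹' S) :=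
  Kernel.measurable_kernel_prodMk_left (κ := quenchedKernel z) hS

theorem measurable_quenchedLaw_apply (z : Lattice d) {B : Set (Path d)} (hB : MeasurableSet B) :
    Measurable fun ω : Env d => quenchedLaw ω z B :=
  Kernel.measurable_coe (quenchedKernel z) hB

theorem measurable_path_apply (n : ℕ) : Measurable fun X : Path d => X n :=
  measurable_pi_apply n

theorem measurable_env_apply (x : Lattice d) : Measurable fun ω : Env d => ω x :=
  measurable_pi_apply x

theorem jointLaw_start (ν : Measure (Env d)) [IsProbabilityMeasure ν] (z : Lattice d) :
    ∀ᵐ p ∂jointLaw ν z, p.2 0 = z := by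
  have hm : MeasurableSet {p : Env d × Path d | p.2 0 = z} :=
    ((measurable_path_apply 0).comp measurable_snd) (measurableSet_singleton z)
  rw [ae_iff, ← Set.compl_ofPred, jointLaw_apply _ _ hm.compl]
  refine (lintegral_congr fun ω => ?_).trans lintegral_zero
  exact ae_iff.1 (quenchedLaw_start ω z)

/-- The law of the environment is invariant under translations. -/
theorem envLaw_map_shiftEnv (v : Lattice d) : (envLaw Q).map (shiftEnv v) = envLaw Q := by
  refine Measure.eq_infinitePi _ fun s t ht => ?_
  have hs : MeasurableSet (Set.pi (s : Set (Lattice d)) t) :=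
    MeasurableSet.pi s.countable_toSet fun i _ => ht i
  rw [Measure.map_apply (measurable_shiftEnv v) hs]
  have h : shiftEnv v ⁻¹' Set.pi (s : Set (Lattice d)) t =
      Set.pi (s.map (addRightEmbedding v) : Finset (Lattice d)) fun x => t (x - v) := by
    ext ω
    simp only [Set.mem_preimage, Set.mem_pi, Finset.mem_coe, Finset.mem_map, addRightEmbedding_apply,
      forall_exists_index, and_imp, forall_apply_eq_imp_iff₂, add_sub_cancel_right]
    rfl
  rw [h, envLaw, Measure.infinitePi_pi _ fun i _ => ht _]
  simp

end EnvLaw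

/-! ### Independence across a level and regeneration times. -/

section Regeneration

variable {d : ℕ} [NeZero d]

/-- The environment which equals `q.1` below the level `a` and `q.2` from the level `a` on. -/
def mixEnv (a : ℤ) (q : Env d × Env d) : Env d := fun x => if level x < a then q.1 x else q.2 x

theorem measurable_mixEnv (a : ℤ) : Measurable (mixEnv (d := d) a) := by
  refine measurable_pi_lambda _ fun x => ?_
  by_cases h : level x < a
  · simp only [mixEnv, h, if_true]
    exact (measurable_env_apply x).comp measurable_fst
  · simp only [mixEnv, h, if_false]
    exact (measurable_env_apply x).comp measurable_snd

variable (Q : Measure (StepLaw d)) [IsProbabilityMeasure Q]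

/-- The sites are independent, so taking those below a level from one copy and the rest from an
independent copy leaves the law unchanged. Independence of the two half-spaces then becomes
Tonelli's theorem. -/
theorem envLaw_map_mixEnv (a : ℤ) :
    ((envLaw Q).prod (envLaw Q)).map (mixEnv a) = envLaw Q := by
  classical
  refine Measure.eq_infinitePi _ fun s t ht => ?_
  have hs : MeasurableSet (Set.pi (s : Set (Lattice d)) t) :=
    MeasurableSet.pi s.countable_toSet fun i _ => ht i
  rw [Measure.map_apply (measurable_mixEnv a) hs]
  have h : mixEnv a ⁻¹' Set.pi (s : Set (Lattice d)) t =
      Set.pi (s.filter fun x => level x < a : Finset (Lattice d)) t ×ˢ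
      Set.pi (s.filter fun x => ¬ level x < a : Finset (Lattice d)) t := by
    ext q
    simp only [Set.mem_preimage, Set.mem_pi, Set.mem_prod, Finset.mem_coe, mem_filter]
    constructor
    · intro h
      refine ⟨fun x hx => ?_, fun x hx => ?_⟩
      · simpa [mixEnv, hx.2] using h x hx.1
      · simpa only [mixEnv, hx.2, if_false] using h x hx.1
    · rintro ⟨h1, h2⟩ x hx
      by_cases hxa : level x < a
      · simpa [mixEnv, hxa] using h1 x ⟨hx, hxa⟩
      · simpa only [mixEnv, hxa, if_false] using h2 x ⟨hx, hxa⟩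
  rw [h, Measure.prod_prod, envLaw, Measure.infinitePi_pi _ fun i _ => ht _,
    Measure.infinitePi_pi _ fun i _ => ht _, prod_filter_mul_prod_filter_not]

/-- The environments below the level `a` and from the level `a` on are independent. -/
theorem lintegral_envLaw_mul (a : ℤ) {f g : Env d → ENNReal} (hf : Measurable f)
    (hg : Measurable g)
    (hfa : ∀ ω ω' : Env d, (∀ x, level x < a → ω x = ω' x) → f ω = f ω')
    (hga : ∀ ω ω' : Env d, (∀ x, a ≤ level x → ω x = ω' x) → g ω = g ω') :
    ∫⁻ ω, f ω * g ω ∂envLaw Q = (∫⁻ ω, f ω ∂envLaw Q) * ∫⁻ ω, g ω ∂envLaw Q := by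
  conv_lhs => rw [← envLaw_map_mixEnv Q a]
  rw [lintegral_map (f := fun ω => f ω * g ω) (hf.mul hg) (measurable_mixEnv a)]
  have h : ∀ q : Env d × Env d, f (mixEnv a q) * g (mixEnv a q) = f q.1 * g q.2 := fun q => by
    congr 1
    · exact hfa _ _ fun x hx => by simp [mixEnv, hx]
    · exact hga _ _ fun x hx => by simp [mixEnv, not_lt.2 hx]
  simp_rw [h]
  exact lintegral_prod_mul hf.aemeasurable hg.aemeasurable

/-- The trajectories which are transient in the direction `ℓ` and which, after time `0`, stay
strictly above their initial level. -/
def upTransient (d : ℕ) [NeZero d] : Set (Path d) :=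
  {X | ∀ s, 0 < s → level (X 0) < level (X s)} ∩ transientPaths d

theorem measurable_level_apply (n : ℕ) : Measurable fun X : Path d => level (X n) :=
  measurable_level.comp (measurable_pi_apply n)

theorem measurableSet_upTransient : MeasurableSet (upTransient d) := by
  refine MeasurableSet.inter ?_ measurableSet_transientPaths
  have h : {X : Path d | ∀ s, 0 < s → level (X 0) < level (X s)} =
      ⋂ s : ℕ, ⋂ _ : 0 < s, {X | level (X 0) < level (X s)} := by
    ext X; simp
  rw [h]
  exact MeasurableSet.iInter fun s => MeasurableSet.iInter fun _ =>
    measurableSet_lt (measurable_level_apply 0) (measurable_level_apply s)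

theorem level_add (x y : Lattice d) : level (x + y) = level x + level y := rfl

theorem level_sub (x y : Lattice d) : level (x - y) = level x - level y := rfl

theorem level_zero : level (0 : Lattice d) = 0 := rfl

theorem subPath_mem_transientPaths_iff {v : Lattice d} {X : Path d} :
    subPath v X ∈ transientPaths d ↔ X ∈ transientPaths d := by
  constructor
  · intro h
    refine (tendsto_atTop_add_const_right atTop (level v) h).congr fun n => ?_
    simp [subPath, level_sub]
  · intro h
    refine (tendsto_atTop_add_const_right atTop (-level v) h).congr fun n => ?_
    rw [subPath, level_sub, sub_eq_add_neg]

theorem shiftPath_mem_transientPaths_iff {n : ℕ} {X : Path d} :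
    shiftPath n X ∈ transientPaths d ↔ X ∈ transientPaths d := by
  have : (fun i => level (shiftPath n X i)) = fun i => level (X (i + n)) := by
    funext i
    rw [shiftPath, add_comm]
  rw [transientPaths, Set.mem_ofPred_eq, this]
  exact tendsto_add_atTop_iff_nat (f := fun i => level (X i)) n

theorem subPath_mem_upTransient_iff {v : Lattice d} {X : Path d} :
    subPath v X ∈ upTransient d ↔ X ∈ upTransient d := by
  simp [upTransient, subPath_mem_transientPaths_iff, subPath, level_sub]

/-- The environment on the half-space `{x | 0 ≤ ⟨x, ℓ⟩}`, extended by the placeholder. -/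
def upperEnv (ω : Env d) : Env d := fun x => if 0 ≤ level x then ω x else defaultLaw d

theorem measurable_upperEnv : Measurable (upperEnv (d := d)) := by
  refine measurable_pi_lambda _ fun x => ?_
  by_cases h : 0 ≤ level x
  · simpa only [upperEnv, h, if_true] using measurable_pi_apply x
  · simpa only [upperEnv, h, if_false] using measurable_const

/-- Forget the environment in the half-space `{x | ⟨x, ℓ⟩ < 0}`. -/
def upperPart (p : Env d × Path d) : Env d × Path d := (upperEnv p.1, p.2)

theorem measurable_upperPart : Measurable (upperPart (d := d)) :=
  (measurable_upperEnv.comp measurable_fst).prodMk measurable_snd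

/-- The environment and the walk seen from the position at time `n`, without the environment
below the level of this position. -/
def recenter (n : ℕ) (p : Env d × Path d) : Env d × Path d :=
  (upperEnv (shiftEnv (p.2 n) p.1), subPath (p.2 n) (shiftPath n p.2))

theorem measurable_recenter (n : ℕ) : Measurable (recenter (d := d) n) := by
  have hX : ∀ i, Measurable fun p : Env d × Path d => p.2 i := fun i =>
    (measurable_path_apply i).comp measurable_snd
  refine Measurable.prodMk (measurable_upperEnv.comp (measurable_pi_lambda _ fun x => ?_))
    (measurable_pi_lambda _ fun i => (hX (n + i)).sub (hX n))
  exact measurable_eval_countable (f := fun p : Env d × Path d => p.1)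
    (g := fun p => x + p.2 n) measurable_fst ((hX n).const_add x)

/-- Started at 0, a trajectory in `upTransient` never visits a negative level. The event does not
itself fix the starting point, so the almost sure condition `X 0 = 0` is intersected with it. -/
theorem quenchedLaw_upTransient_congr {ω ω' : Env d} (h : ∀ x, 0 ≤ level x → ω x = ω' x)
    {B : Set (Path d)} (hB : MeasurableSet B) (hBup : B ⊆ upTransient d) :
    quenchedLaw ω 0 B = quenchedLaw ω' 0 B := by
  set C : Set (Path d) := {X | X 0 = 0}
  have hC : MeasurableSet C :=
    measurable_pi_apply (X := fun _ : ℕ => Lattice d) 0 (measurableSet_singleton 0)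
  have h1 : ∀ ω : Env d, quenchedLaw ω 0 B = quenchedLaw ω 0 (B ∩ C) := fun ω =>
    (measure_inter_conull (ae_iff.1 (quenchedLaw_start ω 0))).symm
  rw [h1, h1]
  refine quenchedLaw_inter_congr {x | 0 ≤ level x} h 0 (hB.inter hC) fun X hX i => ?_
  have h2 : X 0 = 0 := hX.2
  rcases Nat.eq_zero_or_pos i with rfl | hi
  · simp [h2, level_zero]
  · have := (hBup hX.1).1 i hi
    rw [h2, level_zero] at this
    exact this.le

/-- The regeneration property at a deterministic time, on a given initial path which ends at a
strict maximum of the level. -/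
theorem jointLaw_regeneration (n : ℕ) {γ : Path d}
    (hγ : ∀ i < n, level (γ i) < level (γ n)) {V : Set (Env d)} (hV : MeasurableSet V)
    (hVγ : ∀ ω ω' : Env d, (∀ x, level x < level (γ n) → ω x = ω' x) → ω ∈ V → ω' ∈ V)
    {G : Set (Env d × Path d)} (hG : MeasurableSet G) :
    jointLaw (envLaw Q) 0 ({p | p.1 ∈ V ∧ p.2 ∈ cyl n γ ∧ shiftPath n p.2 ∈ upTransient d} ∩
        recenter n ⁻¹' G) =
      jointLaw (envLaw Q) 0 {p | p.1 ∈ V ∧ p.2 ∈ cyl n γ} *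
      jointLaw (envLaw Q) 0 {p | p.2 ∈ upTransient d ∧ upperPart p ∈ G} := by
  have hS1 : MeasurableSet {p : Env d × Path d | p.1 ∈ V ∧ p.2 ∈ cyl n γ} :=
    (measurable_fst hV).inter (measurable_snd (measurableSet_cyl n γ))
  have hS : MeasurableSet
      ({p : Env d × Path d | p.1 ∈ V ∧ p.2 ∈ cyl n γ ∧ shiftPath n p.2 ∈ upTransient d} ∩
        recenter n ⁻¹' G) :=
    ((measurable_fst hV).inter ((measurable_snd (measurableSet_cyl n γ)).inter
      (((measurable_shiftPath n).comp measurable_snd) measurableSet_upTransient))).inter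
      (measurable_recenter n hG)
  have hU : MeasurableSet {p : Env d × Path d | p.2 ∈ upTransient d ∧ upperPart p ∈ G} :=
    (measurable_snd measurableSet_upTransient).inter (measurable_upperPart hG)
  rw [jointLaw_apply _ _ hS1, jointLaw_apply _ _ hS, jointLaw_apply _ _ hU]
  -- The quenched probability of the past is `f`, that of the future, started at 0, is `g`. The
  -- probability to be computed is the integral of `f ω * g (shiftEnv (γ n) ω)`. Since `γ n` is a
  -- strict record, the two factors read the environment on complementary half-spaces.
  set f : Env d → ENNReal := fun ω =>
    quenchedLaw ω 0 (Prod.mk ω ⁻¹' {p | p.1 ∈ V ∧ p.2 ∈ cyl n γ}) with hf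
  set g : Env d → ENNReal := fun ω =>
    quenchedLaw ω 0 (Prod.mk ω ⁻¹' {p | p.2 ∈ upTransient d ∧ upperPart p ∈ G}) with hg
  have hgm : Measurable g := measurable_quenchedLaw_section 0 hU
  have hfm : Measurable f := measurable_quenchedLaw_section 0 hS1
  have hg0 : ∫⁻ ω, g ω ∂envLaw Q = ∫⁻ ω, g (shiftEnv (γ n) ω) ∂envLaw Q := by
    conv_lhs => rw [← envLaw_map_shiftEnv Q (γ n)]
    exact lintegral_map hgm (measurable_shiftEnv _)
  have hgdep : ∀ ω ω' : Env d, (∀ x, 0 ≤ level x → ω x = ω' x) → g ω = g ω' := by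
    intro ω ω' h
    have hup : upperEnv ω = upperEnv ω' := by
      funext x
      by_cases hx : 0 ≤ level x
      · simp [upperEnv, hx, h x hx]
      · simp [upperEnv, hx]
    have hset : (Prod.mk ω ⁻¹' {p | p.2 ∈ upTransient d ∧ upperPart p ∈ G}) =
        (Prod.mk ω' ⁻¹' {p : Env d × Path d | p.2 ∈ upTransient d ∧ upperPart p ∈ G}) := by
      ext X
      simp [upperPart, hup]
    simp only [hg, hset]
    exact quenchedLaw_upTransient_congr h (measurable_prodMk_left hU) fun X hX => hX.1
  rw [hg0]
  refine Eq.trans ?_ (lintegral_envLaw_mul Q (level (γ n)) hfm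
    (hgm.comp (measurable_shiftEnv (γ n))) ?_ ?_)
  · refine lintegral_congr fun ω => ?_
    by_cases hω : ω ∈ V
    · set B : Set (Path d) := subPath (γ n) ⁻¹' (Prod.mk (shiftEnv (γ n) ω) ⁻¹'
        {p | p.2 ∈ upTransient d ∧ upperPart p ∈ G}) with hB
      have hBm : MeasurableSet B := measurable_subPath _ (measurable_prodMk_left hU)
      have h1 : Prod.mk ω ⁻¹'
          ({p | p.1 ∈ V ∧ p.2 ∈ cyl n γ ∧ shiftPath n p.2 ∈ upTransient d} ∩
            recenter n ⁻¹' G) = cyl n γ ∩ shiftPath n ⁻¹' B := by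
        ext X
        simp only [hB, Set.mem_preimage, Set.mem_inter_iff, Set.mem_ofPred_eq, hω, true_and,
          recenter, upperPart, subPath_mem_upTransient_iff, and_assoc]
        refine and_congr_right fun hX => and_congr_right fun _ => ?_
        rw [hX n le_rfl]
      have h2 : Prod.mk ω ⁻¹' {p : Env d × Path d | p.1 ∈ V ∧ p.2 ∈ cyl n γ} = cyl n γ := by
        ext X
        simp [hω]
      simp only [hg, h1, h2]
      rw [quenchedLaw_markov _ _ _ _ hBm, quenchedLaw_shiftEnv ω (γ n) 0, zero_add,
        Measure.map_apply (measurable_subPath _) (measurable_prodMk_left hU)]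
    · simp [hω]
  · intro ω ω' h
    have hVi : ω ∈ V ↔ ω' ∈ V := ⟨hVγ ω ω' h, hVγ ω' ω fun x hx => (h x hx).symm⟩
    by_cases hω : ω ∈ V
    · simp only [Set.preimage_ofPred_eq, hω, hVi.1 hω, true_and]
      exact quenchedLaw_cyl_congr _ _ _ fun i hi => h _ (hγ i hi)
    · simp [hω, mt hVi.2 hω]
  · intro ω ω' h
    refine hgdep _ _ fun x hx => h _ ?_
    rw [level_add]
    omega

theorem jointLaw_cyl_inter_upTransient (n : ℕ) {γ : Path d}
    (hγ : ∀ i < n, level (γ i) < level (γ n)) :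
    jointLaw (envLaw Q) 0 (Prod.snd ⁻¹' (cyl n γ ∩ shiftPath n ⁻¹' upTransient d)) =
      jointLaw (envLaw Q) 0 (Prod.snd ⁻¹' cyl n γ) *
      jointLaw (envLaw Q) 0 (Prod.snd ⁻¹' upTransient d) := by
  have := jointLaw_regeneration Q n hγ MeasurableSet.univ (fun _ _ _ _ => Set.mem_univ _)
    (G := Set.univ) MeasurableSet.univ
  simp only [Set.mem_univ, true_and, Set.preimage_univ, Set.inter_univ, and_true] at this
  exact this

/-- A transient trajectory attains its minimal level, and does so only finitely often; the last such
time works. -/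
theorem exists_shiftPath_mem_upTransient {X : Path d} (hX : X ∈ transientPaths d) :
    ∃ n, shiftPath n X ∈ upTransient d := by
  have hX' : Tendsto (fun n => level (X n)) atTop atTop := hX
  obtain ⟨m, hm⟩ : ∃ m, ∀ n, level (X m) ≤ level (X n) := by
    obtain ⟨N, hN⟩ := (hX'.eventually_ge_atTop (level (X 0))).exists_forall_of_atTop
    obtain ⟨m, hm, hmin⟩ := exists_min_image (range (N + 1)) (fun n => level (X n))
      ⟨0, by simp⟩
    refine ⟨m, fun n => ?_⟩
    rcases lt_or_ge n (N + 1) with h | h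
    · exact hmin n (mem_range.2 h)
    · exact (hmin 0 (by simp)).trans (hN n (by omega))
  obtain ⟨N, hN⟩ := (hX'.eventually_gt_atTop (level (X m))).exists_forall_of_atTop
  have hmN : m ≤ N := not_lt.1 fun h => (hN m h.le).false
  have hne : ((range (N + 1)).filter fun n => level (X n) = level (X m)).Nonempty :=
    ⟨m, by simp; omega⟩
  obtain ⟨n, hn, hmax⟩ := exists_max_image _ (fun n => n) hne
  rw [mem_filter] at hn
  refine ⟨n, fun s hs => ?_, shiftPath_mem_transientPaths_iff.2 hX⟩
  simp only [shiftPath, add_zero]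
  rw [hn.2]
  refine lt_of_le_of_ne (hm _) fun heq => ?_
  rcases lt_or_ge (n + s) (N + 1) with h | h
  · have := hmax (n + s) (mem_filter.2 ⟨mem_range.2 h, heq.symm⟩)
    omega
  · exact (hN (n + s) (by omega)).ne heq

/-- Otherwise, by translation invariance, in almost every environment the event `upTransient` is
null from every site at once. By the Markov property it is then null after each deterministic time,
whereas every transient trajectory satisfies it after some time. -/
theorem jointLaw_upTransient_pos
    (hA : 0 < jointLaw (envLaw Q) 0 (Prod.snd ⁻¹' transientPaths d)) :
    0 < jointLaw (envLaw Q) 0 (Prod.snd ⁻¹' upTransient d) := by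
  refine pos_iff_ne_zero.2 fun h0 => hA.ne' ?_
  rw [jointLaw_apply _ _ (measurable_snd measurableSet_upTransient),
    lintegral_eq_zero_iff (measurable_quenchedLaw_section _
      (measurable_snd measurableSet_upTransient))] at h0
  rw [jointLaw_apply _ _ (measurable_snd measurableSet_transientPaths),
    lintegral_eq_zero_iff (measurable_quenchedLaw_section _
      (measurable_snd measurableSet_transientPaths))]
  have h1 : ∀ x : Lattice d, ∀ᵐ ω ∂envLaw Q, quenchedLaw ω x (upTransient d) = 0 := fun x => by
    rw [← envLaw_map_shiftEnv Q x] at h0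
    have h2 := ae_of_ae_map (measurable_shiftEnv x).aemeasurable h0
    filter_upwards [h2] with ω hω
    have h3 : quenchedLaw (shiftEnv x ω) 0 (upTransient d) = 0 := hω
    rw [quenchedLaw_shiftEnv, zero_add,
      Measure.map_apply (measurable_subPath _) measurableSet_upTransient] at h3
    rw [← h3]
    congr 1
    ext X
    exact subPath_mem_upTransient_iff.symm
  filter_upwards [ae_all_iff.2 h1] with ω hω
  change quenchedLaw ω 0 (transientPaths d) = 0
  refine measure_mono_null (t := ⋃ n, shiftPath n ⁻¹' upTransient d)
    (fun X hX => Set.mem_iUnion.2 (exists_shiftPath_mem_upTransient hX))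
    (measure_iUnion_null fun n => ?_)
  rw [measure_eq_tsum_cyl _ n (measurable_shiftPath n measurableSet_upTransient)]
  refine ENNReal.tsum_eq_zero.2 fun h => ?_
  rw [Set.inter_comm, quenchedLaw_markov _ _ _ _ measurableSet_upTransient, hω, mul_zero]

theorem isRegenerationTime_of_shiftPath {n : ℕ} {X : Path d}
    (h1 : ∀ i < n, level (X i) < level (X n)) (h2 : shiftPath n X ∈ upTransient d) :
    IsRegenerationTime X n := by
  refine ⟨h1, fun s hs => ?_⟩
  have := h2.1 (s - n) (by omega)
  simpa [shiftPath, Nat.add_sub_cancel' hs.le] using this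

theorem IsRegenerationTime.shiftPath_mem {n : ℕ} {X : Path d} (h : IsRegenerationTime X n)
    (hX : X ∈ transientPaths d) : shiftPath n X ∈ upTransient d :=
  ⟨fun s hs => by simpa [shiftPath] using h.2 (n + s) (by omega),
    shiftPath_mem_transientPaths_iff.2 hX⟩

/-- On the event of transience in the direction `ℓ`, there are almost surely infinitely many
regeneration times. -/
theorem ae_infinite_isRegenerationTime
    (hA : 0 < jointLaw (envLaw Q) 0 (Prod.snd ⁻¹' transientPaths d)) :
    ∀ᵐ p ∂jointLaw (envLaw Q) 0, p.2 ∈ transientPaths d →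
      {t | IsRegenerationTime p.2 t}.Infinite := by
  set α : Measure (Path d) := (jointLaw (envLaw Q) 0).map Prod.snd with hα
  have hαp : IsProbabilityMeasure α := Measure.isProbabilityMeasure_map measurable_snd.aemeasurable
  have hαa : ∀ {B : Set (Path d)}, MeasurableSet B →
      α B = jointLaw (envLaw Q) 0 (Prod.snd ⁻¹' B) := fun hB =>
    Measure.map_apply measurable_snd hB
  have h0 : ∀ᵐ X ∂α, X 0 = 0 :=
    (ae_map_iff measurable_snd.aemeasurable (measurable_pi_apply (X := fun _ : ℕ => Lattice d) 0
      (measurableSet_singleton 0))).2 (jointLaw_start _ _)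
  set r : ℝ := α.real (upTransient d) with hr
  have hrpos : 0 < r := by
    rw [hr, Measure.real, hαa measurableSet_upTransient]
    exact ENNReal.toReal_pos (jointLaw_upTransient_pos Q hA).ne' (measure_ne_top _ _)
  -- The event of transience without regeneration from time `k` on. At each record time `n ≥ k`,
  -- whatever the past, a regeneration occurs with probability `r`, so the conditional probability
  -- of `N k` is at most `1 - r`. By Lévy's law it would exceed `1 - r` eventually on almost all of
  -- `N k`, so `N k` is null.
  set N : ℕ → Set (Path d) := fun k =>
    transientPaths d ∩ ⋂ t : ℕ, ⋂ _ : k ≤ t, {X | IsRegenerationTime X t}ᶜ with hN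
  have hNm : ∀ k, MeasurableSet (N k) := fun k => measurableSet_transientPaths.inter
    (MeasurableSet.iInter fun t => MeasurableSet.iInter fun _ =>
      (measurableSet_isRegenerationTime t).compl)
  have hNnull : ∀ k, ∀ᵐ X ∂α, X ∉ N k := by
    intro k
    filter_upwards [h0, ae_lt_measureReal_inter_cyl α (hNm k) (c := 1 - r) (by linarith)]
      with X hX0 hX hXN
    -- A sequence that tends to infinity has infinitely many strict records.
    have hhigh : ∃ᶠ n in atTop, ∀ i < n, level (X i) < level (X n) :=
      frequently_high_scores hXN.1
    obtain ⟨n, hn, hlt, hkn⟩ := (hhigh.and_eventually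
      ((hX hXN).and (eventually_ge_atTop k))).exists
    have h1 : α.real (cyl n X ∩ shiftPath n ⁻¹' upTransient d) = α.real (cyl n X) * r := by
      have h2 := jointLaw_cyl_inter_upTransient Q n hn
      rw [← hαa ((measurableSet_cyl n X).inter
        (measurable_shiftPath n measurableSet_upTransient)), ← hαa (measurableSet_cyl n X),
        ← hαa measurableSet_upTransient] at h2
      rw [Measure.real, h2, ENNReal.toReal_mul]
      rfl
    have h3 : N k ∩ cyl n X ⊆ cyl n X \ (cyl n X ∩ shiftPath n ⁻¹' upTransient d) := by
      rintro Y ⟨hY1, hY2⟩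
      refine ⟨hY2, fun hY3 => ?_⟩
      refine Set.mem_iInter₂.1 hY1.2 n hkn (isRegenerationTime_of_shiftPath (fun i hi => ?_) hY3.2)
      rw [hY2 i hi.le, hY2 n le_rfl]
      exact hn i hi
    have h4 := measureReal_mono h3 (measure_ne_top α _)
    rw [measureReal_sdiff Set.inter_subset_left ((measurableSet_cyl n X).inter
        (measurable_shiftPath n measurableSet_upTransient)), h1] at h4
    nlinarith
  have h5 := ae_of_ae_map measurable_snd.aemeasurable (ae_all_iff.2 hNnull)
  filter_upwards [h5] with p hp hpA
  refine Set.infinite_of_not_bddAbove fun ⟨k, hk⟩ => hp (k + 1) ⟨hpA, ?_⟩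
  refine Set.mem_iInter₂.2 fun t ht hreg => ?_
  have := hk hreg
  omega

end Regeneration


/-! ### The first two regeneration times -/

section RegTime

variable {d : ℕ} [NeZero d]

theorem regTime_zero_eq {X : Path d} {n : ℕ} (hn : IsRegenerationTime X n)
    (h : ∀ k < n, ¬ IsRegenerationTime X k) : regTime X 0 = n := by
  classical
  have hc : Nat.count (IsRegenerationTime X) n = 0 := by
    rw [Nat.count_eq_card_filter_range, card_eq_zero, filter_eq_empty_iff]
    exact fun k hk => h k (mem_range.1 hk)
  rw [regTime, ← hc]
  exact Nat.nth_count hn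

theorem regTime_one_eq {X : Path d} {m n : ℕ} (hm : IsRegenerationTime X m)
    (hn : IsRegenerationTime X n) (hmn : m < n) (h : ∀ k < n, IsRegenerationTime X k → k = m) :
    regTime X 1 = n := by
  classical
  have hc : Nat.count (IsRegenerationTime X) n = 1 := by
    rw [Nat.count_eq_card_filter_range, card_eq_one]
    refine ⟨m, ?_⟩
    ext k
    simp only [mem_filter, mem_range, mem_singleton]
    exact ⟨fun hk => h k hk.1 hk.2, fun hk => by subst hk; exact ⟨hmn, hm⟩⟩
  rw [regTime, ← hc]
  exact Nat.nth_count hn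

theorem exists_regTime_zero {X : Path d} (h : ∃ t, IsRegenerationTime X t) :
    IsRegenerationTime X (regTime X 0) ∧ ∀ k < regTime X 0, ¬ IsRegenerationTime X k := by
  classical
  have h1 := Nat.find_spec h
  have h2 : ∀ k < Nat.find h, ¬ IsRegenerationTime X k := fun k hk => Nat.find_min h hk
  rw [regTime_zero_eq h1 h2]
  exact ⟨h1, h2⟩

theorem exists_regTime_one {X : Path d} {m : ℕ} (hm : IsRegenerationTime X m)
    (hmin : ∀ k < m, ¬ IsRegenerationTime X k) (h : ∃ t, m < t ∧ IsRegenerationTime X t) :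
    m < regTime X 1 ∧ IsRegenerationTime X (regTime X 1) ∧
      ∀ k < regTime X 1, IsRegenerationTime X k → k = m := by
  classical
  have h1 := Nat.find_spec h
  have h2 : ∀ k < Nat.find h, IsRegenerationTime X k → k = m := fun k hk hreg => by
    have h3 := Nat.find_min h hk
    have h4 : ¬ k < m := fun hk => hmin k hk hreg
    by_contra hne
    exact h3 ⟨by omega, hreg⟩
  rw [regTime_one_eq hm h1.2 h1.1 h2]
  exact ⟨h1.1, h1.2, h2⟩

/-- The time `k` is a regeneration time of the finite path `γ` on `[0, n]`. -/
def IsRegenerationTimeUpTo (n : ℕ) (γ : Path d) (k : ℕ) : Prop :=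
  (∀ s, s < k → level (γ s) < level (γ k)) ∧ ∀ s, k < s → s ≤ n → level (γ k) < level (γ s)

/-- After a regeneration time `n` the walk stays above its level at `n`, which already dominates the
level at `k`. So, given that `n` regenerates, whether it is the first or second such time is decided
by the path on `[0, n]`. -/
theorem isRegenerationTime_iff_upTo {X γ : Path d} {n k : ℕ} (hX : X ∈ cyl n γ)
    (hn : IsRegenerationTime X n) (hk : k ≤ n) :
    IsRegenerationTime X k ↔ IsRegenerationTimeUpTo n γ k := by
  refine and_congr (forall₂_congr fun s hs => by rw [hX s (by omega), hX k hk]) ?_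
  constructor
  · intro h s hs hsn
    rw [← hX s hsn, ← hX k hk]
    exact h s hs
  · intro h s hs
    by_cases hsn : s ≤ n
    · rw [hX s hsn, hX k hk]
      exact h s hs hsn
    · have h1 := hn.2 s (by omega)
      rcases hk.lt_or_eq with hk' | rfl
      · have h2 := h n hk' le_rfl
        rw [← hX k hk, ← hX n le_rfl] at h2
        exact h2.trans h1
      · exact h1

/-- The part of the walk discarded by the shift lies below the level at `m`, hence imposes no
further condition on later times. -/
theorem isRegenerationTime_shift_iff {X : Path d} {m : ℕ} (hm : IsRegenerationTime X m)
    (v : Lattice d) (k : ℕ) :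
    IsRegenerationTime (subPath v (shiftPath m X)) k ↔ IsRegenerationTime X (m + k) := by
  simp only [IsRegenerationTime, subPath, shiftPath, level_sub, sub_lt_sub_iff_right]
  refine and_congr ⟨fun h s hs => ?_, fun h s hs => h _ (by omega)⟩
    ⟨fun h s hs => ?_, fun h s hs => h _ (by omega)⟩
  · rcases lt_trichotomy s m with hsm | rfl | hsm
    · rcases Nat.eq_zero_or_pos k with rfl | hk
      · exact hm.1 s hsm
      · exact (hm.1 s hsm).trans (hm.2 _ (by omega))
    · simpa using h 0 (by omega)
    · obtain ⟨j, rfl⟩ := Nat.exists_eq_add_of_le hsm.le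
      exact h j (by omega)
  · obtain ⟨j, rfl⟩ := Nat.exists_eq_add_of_le (show m ≤ s by omega)
    exact h j (by omega)

theorem isRegenerationTime_zero {X : Path d} (hX : X ∈ upTransient d) :
    IsRegenerationTime X 0 :=
  ⟨fun s hs => absurd hs (Nat.not_lt_zero s), hX.1⟩

theorem regTime_zero_of_upTransient {X : Path d} (hX : X ∈ upTransient d) : regTime X 0 = 0 :=
  regTime_zero_eq (isRegenerationTime_zero hX) fun k hk => absurd hk (Nat.not_lt_zero k)

end RegTime

/-! ### The law of the environment and the walk after a regeneration time -/

section UpLaw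

/-- The pairs formed by a value of `τ` and the path up to that time are countably many; this reduces
a random time to deterministic ones. -/
theorem measure_eq_tsum_time {d : ℕ} (μ : Measure (Env d × Path d)) {τ : Path d → ℕ} (hτ : Measurable τ)
    {F : Set (Env d × Path d)} (hF : MeasurableSet F) :
    μ F = ∑' i : (Σ n : ℕ, (Iic n → Lattice d)),
      μ (F ∩ {p | τ p.2 = i.1 ∧ p.2 ∈ cyl i.1 (extendPath i.2)}) := by
  have hm : ∀ i : (Σ n : ℕ, (Iic n → Lattice d)), MeasurableSet
      {p : Env d × Path d | τ p.2 = i.1 ∧ p.2 ∈ cyl i.1 (extendPath i.2)} := fun i =>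
    ((hτ.comp measurable_snd) (measurableSet_singleton i.1)).inter
      (measurable_snd (measurableSet_cyl _ _))
  rw [← measure_iUnion _ fun i => hF.inter (hm i)]
  · congr 1
    ext p
    simp only [Set.mem_iUnion, Set.mem_inter_iff, Set.mem_ofPred_eq]
    exact ⟨fun hp => ⟨⟨τ p.2, initPath _ p.2⟩, hp, rfl, mem_cyl_extendPath_iff.2 rfl⟩,
      fun ⟨_, hp, _⟩ => hp⟩
  · rintro ⟨n, h⟩ ⟨n', h'⟩ hne
    refine Set.disjoint_left.2 fun p hp hp' => hne ?_
    obtain ⟨-, h1, h2⟩ := hp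
    obtain ⟨-, h1', h2'⟩ := hp'
    have h3 : n = n' := h1.symm.trans h1'
    subst h3
    exact congrArg _ ((mem_cyl_extendPath_iff.1 h2).symm.trans (mem_cyl_extendPath_iff.1 h2'))

theorem Slab.ext' {d : ℕ} {S T : Slab d} (hL : S.L = T.L) (hW : S.W = T.W) (hu : S.u = T.u)
    (hK : S.K = T.K) : S = T := by
  cases S; cases T; simp_all

variable {d : ℕ} [NeZero d] (Q : Measure (StepLaw d)) [IsProbabilityMeasure Q]

/-- The law of the environment in the upper half-space and of the walk, conditioned on the walk
being transient and never coming back to its initial level. -/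
def upLaw (Q : Measure (StepLaw d)) : Measure (Env d × Path d) :=
  (cond (jointLaw (envLaw Q) 0) (Prod.snd ⁻¹' upTransient d)).map upperPart

theorem isProbabilityMeasure_upLaw
    (hA : 0 < jointLaw (envLaw Q) 0 (Prod.snd ⁻¹' transientPaths d)) :
    IsProbabilityMeasure (upLaw Q) := by
  have := cond_isProbabilityMeasure (jointLaw_upTransient_pos Q hA).ne'
  exact Measure.isProbabilityMeasure_map measurable_upperPart.aemeasurable

theorem jointLaw_eq_mul_upLaw
    (hA : 0 < jointLaw (envLaw Q) 0 (Prod.snd ⁻¹' transientPaths d))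
    {G : Set (Env d × Path d)} (hG : MeasurableSet G) :
    jointLaw (envLaw Q) 0 {p | p.2 ∈ upTransient d ∧ upperPart p ∈ G} =
      jointLaw (envLaw Q) 0 (Prod.snd ⁻¹' upTransient d) * upLaw Q G := by
  rw [upLaw, Measure.map_apply measurable_upperPart hG,
    cond_apply (measurable_snd measurableSet_upTransient), ← mul_assoc,
    ENNReal.mul_inv_cancel (jointLaw_upTransient_pos Q hA).ne' (measure_ne_top _ _), one_mul]
  rfl

/-- The regeneration property at a random time `τ`: the environment and the walk seen from the
position at time `τ` are independent of events which only concern the walk before time `τ`, the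
environment below its level, and the fact that `τ` is a regeneration time. -/
theorem jointLaw_inter_recenter
    (hA : 0 < jointLaw (envLaw Q) 0 (Prod.snd ⁻¹' transientPaths d))
    {τ : Path d → ℕ} (hτ : Measurable τ) {E : Set (Env d × Path d)} (hE : MeasurableSet E)
    (hEτ : ∀ (n : ℕ) (γ : Path d), ∃ V : Set (Env d), MeasurableSet V ∧
      (∀ ω ω' : Env d, (∀ x, level x < level (γ n) → ω x = ω' x) → ω ∈ V → ω' ∈ V) ∧
      (V.Nonempty → ∀ i < n, level (γ i) < level (γ n)) ∧
      E ∩ {p | τ p.2 = n ∧ p.2 ∈ cyl n γ} =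
        {p | p.1 ∈ V ∧ p.2 ∈ cyl n γ ∧ shiftPath n p.2 ∈ upTransient d})
    {G : Set (Env d × Path d)} (hG : MeasurableSet G) :
    jointLaw (envLaw Q) 0 (E ∩ {p | recenter (τ p.2) p ∈ G}) =
      jointLaw (envLaw Q) 0 E * upLaw Q G := by
  have hupLaw := isProbabilityMeasure_upLaw Q hA
  have hGm : MeasurableSet {p : Env d × Path d | recenter (τ p.2) p ∈ G} :=
    measurable_eval_countable (f := fun p n => recenter n p) (g := fun p => τ p.2)
      (measurable_pi_lambda _ fun n => measurable_recenter n) (hτ.comp measurable_snd) hG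
  rw [measure_eq_tsum_time _ hτ (hE.inter hGm), measure_eq_tsum_time _ hτ hE,
    ← ENNReal.tsum_mul_right]
  refine tsum_congr fun ⟨n, h⟩ => ?_
  obtain ⟨V, hV, hVdep, hVlt, hVeq⟩ := hEτ n (extendPath h)
  have hset : E ∩ {p | recenter (τ p.2) p ∈ G} ∩ {p | τ p.2 = n ∧ p.2 ∈ cyl n (extendPath h)} =
      {p | p.1 ∈ V ∧ p.2 ∈ cyl n (extendPath h) ∧ shiftPath n p.2 ∈ upTransient d} ∩
        recenter n ⁻¹' G := by
    rw [← hVeq]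
    ext p
    constructor
    · rintro ⟨⟨h1, h2⟩, h3, h4⟩
      refine ⟨⟨h1, h3, h4⟩, ?_⟩
      rw [← h3]
      exact h2
    · rintro ⟨⟨h1, h3, h4⟩, h2⟩
      refine ⟨⟨h1, ?_⟩, h3, h4⟩
      rw [Set.mem_ofPred_eq, h3]
      exact h2
  simp only
  rw [hset, hVeq]
  -- If `V` is empty, `γ` need not end at a record, and both sides vanish. Otherwise the
  -- deterministic case applies, and its instance with `G` the whole space identifies the remaining
  -- factor as the probability of this piece of `E`.
  rcases V.eq_empty_or_nonempty with rfl | hne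
  · simp
  · rw [jointLaw_regeneration Q n (hVlt hne) hV hVdep hG, jointLaw_eq_mul_upLaw Q hA hG]
    have h1 := jointLaw_regeneration Q n (hVlt hne) hV hVdep MeasurableSet.univ
    rw [jointLaw_eq_mul_upLaw Q hA MeasurableSet.univ, measure_univ, mul_one, Set.preimage_univ,
      Set.inter_univ] at h1
    rw [h1, mul_assoc]

/-- The first regeneration slab, as a function of the environment and the walk. -/
def slabOf (p : Env d × Path d) : Slab d := firstSlab p.1 p.2

theorem measurable_slabOf : Measurable (slabOf (d := d)) := measurable_firstSlab

/-- The environment and the walk seen from the second regeneration time. -/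
def nextPair (p : Env d × Path d) : Env d × Path d := recenter (regTime p.2 1) p

theorem measurable_recenter_regTime (j : ℕ) :
    Measurable fun p : Env d × Path d => recenter (regTime p.2 j) p :=
  measurable_eval_countable (f := fun p n => recenter n p) (g := fun p => regTime p.2 j)
    (measurable_pi_lambda _ fun n => measurable_recenter n)
    ((measurable_regTime j).comp measurable_snd)

theorem measurable_nextPair : Measurable (nextPair (d := d)) := measurable_recenter_regTime 1

theorem slabOf_W_of_mem {p : Env d × Path d} {z : Lattice d} (hz : z ∈ slabSites d (slabOf p).L) :
    (slabOf p).W z = p.1 (z + p.2 (regTime p.2 0)) :=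
  if_pos hz

theorem slabOf_W_of_notMem {p : Env d × Path d} {z : Lattice d}
    (hz : z ∉ slabSites d (slabOf p).L) : (slabOf p).W z = defaultLaw d :=
  if_neg hz

/-- The first regeneration slab only depends on the walk and the environment seen from the first
regeneration time. -/
theorem slabOf_recenter {p : Env d × Path d} (h : {t | IsRegenerationTime p.2 t}.Infinite) :
    slabOf (recenter (regTime p.2 0) p) = slabOf p := by
  obtain ⟨h1, h2⟩ := exists_regTime_zero h.nonempty
  obtain ⟨t, ht, hlt⟩ := h.exists_gt (regTime p.2 0)
  obtain ⟨h3, h4, h5⟩ := exists_regTime_one h1 h2 ⟨t, hlt, ht⟩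
  set m := regTime p.2 0 with hm
  set n := regTime p.2 1 with hn
  have hr0 : regTime (recenter m p).2 0 = 0 :=
    regTime_zero_eq ((isRegenerationTime_shift_iff h1 _ _).2 h1) fun k hk =>
      absurd hk (Nat.not_lt_zero k)
  have hr1 : regTime (recenter m p).2 1 = n - m := by
    refine regTime_one_eq (m := 0) ((isRegenerationTime_shift_iff h1 _ _).2 h1)
      ((isRegenerationTime_shift_iff h1 _ _).2 (by rwa [Nat.add_sub_cancel' h3.le])) (by omega)
      fun k hk hreg => ?_
    have := h5 _ (by omega) ((isRegenerationTime_shift_iff h1 _ _).1 hreg)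
    omega
  have hL : level ((recenter m p).2 (n - m)) - level ((recenter m p).2 0) =
      level (p.2 n) - level (p.2 m) := by
    simp only [recenter, subPath, shiftPath, level_sub, Nat.add_sub_cancel' h3.le, add_zero]
    ring
  have hLs : (slabOf (recenter m p)).L = (slabOf p).L := by
    simp only [slabOf, firstSlab, hr0, hr1, hL, ← hm, ← hn]
  refine Slab.ext' hLs ?_ ?_ ?_
  · funext z
    by_cases hz : z ∈ slabSites d (slabOf p).L
    · have h0 : (recenter m p).2 0 = 0 := by simp [recenter, subPath, shiftPath]
      rw [slabOf_W_of_mem hz, slabOf_W_of_mem (hLs ▸ hz), hr0, h0, add_zero, ← hm]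
      exact if_pos hz.1
    · rw [slabOf_W_of_notMem hz, slabOf_W_of_notMem (hLs ▸ hz)]
  · simp only [slabOf, firstSlab, hr0, hr1, ← hm, ← hn, Nat.sub_zero]
  · funext t
    simp only [slabOf, firstSlab, hr0, hr1, ← hm, ← hn, Nat.sub_zero, zero_add]
    simp only [recenter, subPath, shiftPath, add_zero, sub_self, sub_zero]

/-- The law of the first regeneration slab, in terms of the walk conditioned on regenerating at
time `0`. -/
theorem slabLaw_eq_map_upLaw
    (hA : 0 < jointLaw (envLaw Q) 0 (Prod.snd ⁻¹' transientPaths d)) :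
    slabLaw Q = (upLaw Q).map slabOf := by
  set P := jointLaw (envLaw Q) 0 with hP
  ext B hB
  rw [slabLaw, Measure.map_apply measurable_firstSlab hB,
    cond_apply (measurable_snd measurableSet_transientPaths),
    Measure.map_apply measurable_slabOf hB, ← hP]
  -- Existence of a regeneration time is part of the event because `regTime` has the default value
  -- 0. Almost surely it follows from transience.
  set E : Set (Env d × Path d) :=
    {p | p.2 ∈ transientPaths d ∧ ∃ t, IsRegenerationTime p.2 t} with hEdef
  have hE : MeasurableSet E := by
    have : E = Prod.snd ⁻¹' transientPaths d ∩
        Prod.snd ⁻¹' (⋃ t : ℕ, {X : Path d | IsRegenerationTime X t}) := by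
      ext p; simp [E]
    rw [this]
    exact (measurable_snd measurableSet_transientPaths).inter
      (measurable_snd (MeasurableSet.iUnion fun t => measurableSet_isRegenerationTime t))
  have hinf := ae_infinite_isRegenerationTime Q hA
  have h1 : P E = P (Prod.snd ⁻¹' transientPaths d) := by
    refine measure_congr ?_
    filter_upwards [hinf] with p hp
    exact propext ⟨fun h => h.1, fun h => ⟨h, (hp h).nonempty⟩⟩
  have h2 : P (Prod.snd ⁻¹' transientPaths d ∩
      (fun p : Env d × Path d => firstSlab p.1 p.2) ⁻¹' B) =
      P (E ∩ {p | recenter (regTime p.2 0) p ∈ slabOf ⁻¹' B}) := by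
    refine measure_congr ?_
    filter_upwards [hinf] with p hp
    refine propext ⟨fun h => ⟨⟨h.1, (hp h.1).nonempty⟩, ?_⟩, fun h => ⟨h.1.1, ?_⟩⟩
    · rw [Set.mem_ofPred_eq, Set.mem_preimage, slabOf_recenter (hp h.1)]
      exact h.2
    · have h3 := h.2
      rw [Set.mem_ofPred_eq, Set.mem_preimage, slabOf_recenter (hp h.1.1)] at h3
      exact h3
  rw [h2, jointLaw_inter_recenter Q hA (measurable_regTime 0) hE _ (measurable_slabOf hB), ← hP,
    h1, ← mul_assoc, ENNReal.inv_mul_cancel hA.ne' (measure_ne_top _ _), one_mul]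
  classical
  intro n γ
  -- A condition on the path alone, so `V` is everything or empty: `n` is a record and no earlier
  -- time regenerates on `[0, n]`.
  set good : Prop := (∀ i < n, level (γ i) < level (γ n)) ∧
    ∀ k < n, ¬ IsRegenerationTimeUpTo n γ k with hgood
  refine ⟨{_ω | good}, MeasurableSet.const _, fun _ _ _ h => h, fun ⟨_, h⟩ => h.1, ?_⟩
  ext p
  constructor
  · rintro ⟨⟨hp1, hp2⟩, hp3, hp4⟩
    obtain ⟨h3, h4⟩ := exists_regTime_zero hp2
    rw [hp3] at h3 h4
    refine ⟨⟨fun i hi => ?_, fun k hk => ?_⟩, hp4, h3.shiftPath_mem hp1⟩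
    · rw [← hp4 i hi.le, ← hp4 n le_rfl]
      exact h3.1 i hi
    · rw [← isRegenerationTime_iff_upTo hp4 h3 hk.le]
      exact h4 k hk
  · rintro ⟨⟨hp1, hp2⟩, hp3, hp4⟩
    have h3 : IsRegenerationTime p.2 n := isRegenerationTime_of_shiftPath (fun i hi => by
      rw [hp3 i hi.le, hp3 n le_rfl]; exact hp1 i hi) hp4
    refine ⟨⟨shiftPath_mem_transientPaths_iff.1 hp4.2, n, h3⟩, regTime_zero_eq h3 fun k hk => ?_,
      hp3⟩
    rw [isRegenerationTime_iff_upTo hp3 h3 hk.le]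
    exact hp2 k hk

open Classical in
/-- The slab of the path `γ` on `[0, n]` in the environment `ω`. -/
def finiteSlab (n : ℕ) (γ : Path d) (ω : Env d) : Slab d where
  L := level (γ n) - level (γ 0)
  W := fun z => if z ∈ slabSites d (level (γ n) - level (γ 0)) then ω (z + γ 0) else defaultLaw d
  u := n
  K := fun t => γ (min t n) - γ 0

theorem measurable_finiteSlab (n : ℕ) (γ : Path d) : Measurable (finiteSlab n γ) := by
  refine measurable_comap_iff.2 ((measurable_const (a := level (γ n) - level (γ 0))).prodMk
    (Measurable.prodMk ?_ (measurable_const (a := (n, fun t => γ (min t n) - γ 0)))))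
  refine measurable_pi_lambda _ fun z => ?_
  by_cases hz : z ∈ slabSites d (level (γ n) - level (γ 0))
  · simp only [finiteSlab, hz, if_true]
    exact measurable_env_apply _
  · simp only [finiteSlab, hz, if_false]
    exact measurable_const

/-- The top of the slab is at the level of `γ n`, excluded. This makes the first slab an event of
the past in the regeneration property. -/
theorem finiteSlab_congr {n : ℕ} {γ : Path d} {ω ω' : Env d}
    (h : ∀ x, level x < level (γ n) → ω x = ω' x) : finiteSlab n γ ω = finiteSlab n γ ω' := by
  refine Slab.ext' rfl ?_ rfl rfl
  funext z
  by_cases hz : z ∈ slabSites d (level (γ n) - level (γ 0))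
  · simp only [finiteSlab, hz, if_true]
    have := hz.2
    exact h _ (by rw [level_add]; omega)
  · simp only [finiteSlab, hz, if_false]

theorem slabOf_eq_finiteSlab {p : Env d × Path d} {n : ℕ} {γ : Path d} (hp : p.2 ∈ cyl n γ)
    (h0 : regTime p.2 0 = 0) (h1 : regTime p.2 1 = n) : slabOf p = finiteSlab n γ p.1 := by
  have hL : (slabOf p).L = level (γ n) - level (γ 0) := by
    simp only [slabOf, firstSlab, h0, h1, hp 0 (Nat.zero_le n), hp n le_rfl]
  refine Slab.ext' hL ?_ ?_ ?_
  · funext z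
    by_cases hz : z ∈ slabSites d (level (γ n) - level (γ 0))
    · rw [slabOf_W_of_mem (hL ▸ hz), h0, hp 0 (Nat.zero_le n)]
      exact (if_pos hz).symm
    · rw [slabOf_W_of_notMem (hL ▸ hz)]
      exact (if_neg hz).symm
  · simp only [slabOf, firstSlab, finiteSlab, h0, h1, Nat.sub_zero]
  · funext t
    simp only [slabOf, firstSlab, finiteSlab, h0, h1, Nat.sub_zero, zero_add,
      hp 0 (Nat.zero_le n), hp _ (min_le_right t n)]

/-- Pairs of an environment and a walk started at `0` which regenerates at time `0` and at
infinitely many times. -/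
def IsRegenerating (p : Env d × Path d) : Prop :=
  p.2 0 = 0 ∧ p.2 ∈ upTransient d ∧ {t | IsRegenerationTime p.2 t}.Infinite

theorem IsRegenerating.regTime_one {p : Env d × Path d} (h : IsRegenerating p) :
    0 < regTime p.2 1 ∧ IsRegenerationTime p.2 (regTime p.2 1) ∧
      ∀ k < regTime p.2 1, IsRegenerationTime p.2 k → k = 0 := by
  obtain ⟨t, ht, hlt⟩ := h.2.2.exists_gt 0
  exact exists_regTime_one (isRegenerationTime_zero h.2.1)
    (fun k hk => absurd hk (Nat.not_lt_zero k)) ⟨t, hlt, ht⟩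

theorem IsRegenerating.nextPair {p : Env d × Path d} (h : IsRegenerating p) :
    IsRegenerating (nextPair p) := by
  obtain ⟨h1, h2, -⟩ := h.regTime_one
  refine ⟨by simp [RWRE.nextPair, recenter, subPath, shiftPath],
    subPath_mem_upTransient_iff.2 (h2.shiftPath_mem h.2.1.2), ?_⟩
  refine Set.infinite_of_not_bddAbove fun ⟨k, hk⟩ => ?_
  obtain ⟨t, ht, hlt⟩ := h.2.2.exists_gt (regTime p.2 1 + k)
  obtain ⟨j, rfl⟩ := Nat.exists_eq_add_of_le (show regTime p.2 1 ≤ t by omega)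
  have : j ≤ k := hk ((isRegenerationTime_shift_iff h2 _ _).2 ht)
  omega

theorem upperEnv_apply {ω : Env d} {x : Lattice d} (hx : 0 ≤ level x) : upperEnv ω x = ω x :=
  if_pos hx

theorem slabOf_upperPart {p : Env d × Path d} (h : IsRegenerating p) :
    slabOf (upperPart p) = slabOf p := by
  have h0 := regTime_zero_of_upTransient h.2.1
  refine Slab.ext' rfl ?_ rfl rfl
  funext z
  by_cases hz : z ∈ slabSites d (slabOf p).L
  · have h1 : (slabOf (upperPart p)).W z = upperEnv p.1 (z + p.2 (regTime p.2 0)) :=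
      slabOf_W_of_mem (p := upperPart p) hz
    rw [h1, slabOf_W_of_mem hz, h0, h.1, add_zero, upperEnv_apply hz.1]
  · rw [slabOf_W_of_notMem hz]
    exact slabOf_W_of_notMem (p := upperPart p) hz

/-- The second regeneration point has positive level, so the half-space above it avoids the erased
sites. -/
theorem nextPair_upperPart {p : Env d × Path d} (h : IsRegenerating p) :
    nextPair (upperPart p) = nextPair p := by
  obtain ⟨h1, h2, -⟩ := h.regTime_one
  refine Prod.ext ?_ rfl
  funext x
  simp only [nextPair, recenter, upperPart, upperEnv, shiftEnv]
  refine if_ctx_congr Iff.rfl (fun hx => if_pos ?_) fun _ => rfl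
  have h3 := h2.1 0 h1
  rw [h.1, level_zero] at h3
  rw [level_add]
  omega

theorem ae_isRegenerating
    (hA : 0 < jointLaw (envLaw Q) 0 (Prod.snd ⁻¹' transientPaths d)) :
    ∀ᵐ p ∂jointLaw (envLaw Q) 0, p.2 ∈ upTransient d → IsRegenerating p := by
  filter_upwards [ae_infinite_isRegenerationTime Q hA, jointLaw_start (envLaw Q) 0] with p h1 h2 h3
  exact ⟨h2, h3, h1 h3.2⟩

/-- The first slab and the environment and the walk seen from the end of this slab are independent,
and the latter have the same law as at the beginning. -/
theorem upLaw_slabOf_nextPair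
    (hA : 0 < jointLaw (envLaw Q) 0 (Prod.snd ⁻¹' transientPaths d))
    {B : Set (Slab d)} (hB : MeasurableSet B) {G : Set (Env d × Path d)} (hG : MeasurableSet G) :
    upLaw Q {p | slabOf p ∈ B ∧ nextPair p ∈ G} = slabLaw Q B * upLaw Q G := by
  have hupLaw := isProbabilityMeasure_upLaw Q hA
  set P := jointLaw (envLaw Q) 0 with hP
  set E : Set (Env d × Path d) :=
    {p | p.2 ∈ upTransient d ∧ (∃ t, 0 < t ∧ IsRegenerationTime p.2 t) ∧ slabOf p ∈ B} with hEdef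
  have hE : MeasurableSet E := by
    have : E = Prod.snd ⁻¹' upTransient d ∩
        (Prod.snd ⁻¹' (⋃ t : ℕ, ⋃ _ : 0 < t, {X : Path d | IsRegenerationTime X t}) ∩
          slabOf ⁻¹' B) := by
      ext p; simp [E]
    rw [this]
    exact (measurable_snd measurableSet_upTransient).inter
      ((measurable_snd (MeasurableSet.iUnion fun t => MeasurableSet.iUnion fun _ =>
        measurableSet_isRegenerationTime t)).inter (measurable_slabOf hB))
  -- Kept general in `G`: the case of the whole space evaluates the probability of `E`.
  have key : ∀ {G : Set (Env d × Path d)}, MeasurableSet G →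
      P (Prod.snd ⁻¹' upTransient d) * upLaw Q {p | slabOf p ∈ B ∧ nextPair p ∈ G} =
        P E * upLaw Q G := by
    intro G hG
    have hm : MeasurableSet {p : Env d × Path d | slabOf p ∈ B ∧ nextPair p ∈ G} :=
      (measurable_slabOf hB).inter (measurable_nextPair hG)
    rw [← jointLaw_eq_mul_upLaw Q hA hm,
      ← jointLaw_inter_recenter Q hA (measurable_regTime 1) hE _ hG]
    · refine measure_congr ?_
      filter_upwards [ae_isRegenerating Q hA] with p hp
      refine propext ⟨fun ⟨h1, h2, h3⟩ => ?_, fun ⟨⟨h1, h2, h3⟩, h4⟩ => ⟨h1, ?_, ?_⟩⟩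
      · rw [slabOf_upperPart (hp h1)] at h2
        rw [nextPair_upperPart (hp h1)] at h3
        exact ⟨⟨h1, ⟨_, (hp h1).regTime_one.1, (hp h1).regTime_one.2.1⟩, h2⟩, h3⟩
      · rwa [slabOf_upperPart (hp h1)]
      · rw [nextPair_upperPart (hp h1)]
        exact h4
    · intro n γ
      -- The part of "0 and `n` are the first two regeneration times" that is visible on `[0, n]`.
      -- The environment enters only through the slab, which is cut off at the level of `γ n`.
      set good : Prop := 0 < n ∧ (∀ i < n, level (γ i) < level (γ n)) ∧
        (∀ i, 0 < i → i ≤ n → level (γ 0) < level (γ i)) ∧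
        ∀ k < n, IsRegenerationTimeUpTo n γ k → k = 0 with hgood
      refine ⟨{_ω | good} ∩ finiteSlab n γ ⁻¹' B,
        (MeasurableSet.const _).inter (measurable_finiteSlab n γ hB), ?_,
        fun ⟨_, h⟩ => h.1.2.1, ?_⟩
      · intro ω ω' h hω
        refine ⟨hω.1, ?_⟩
        rw [Set.mem_preimage, ← finiteSlab_congr h]
        exact hω.2
      ext p
      constructor
      · rintro ⟨⟨hp1, hp2, hp3⟩, hp4, hp5⟩
        have h0 := regTime_zero_of_upTransient hp1
        obtain ⟨h1, h2, h3⟩ := exists_regTime_one (isRegenerationTime_zero hp1)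
          (fun k hk => absurd hk (Nat.not_lt_zero k)) hp2
        rw [slabOf_eq_finiteSlab hp5 h0 hp4] at hp3
        rw [hp4] at h1 h2 h3
        refine ⟨⟨⟨h1, fun i hi => ?_, fun i hi hin => ?_, fun k hk hreg => ?_⟩, hp3⟩, hp5,
          h2.shiftPath_mem hp1.2⟩
        · rw [← hp5 i hi.le, ← hp5 n le_rfl]
          exact h2.1 i hi
        · rw [← hp5 i hin, ← hp5 0 (Nat.zero_le n)]
          exact hp1.1 i hi
        · exact h3 k hk ((isRegenerationTime_iff_upTo hp5 h2 hk.le).2 hreg)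
      · rintro ⟨⟨⟨h1, h2, h3, h4⟩, hp1⟩, hp2, hp3⟩
        have hn : IsRegenerationTime p.2 n := isRegenerationTime_of_shiftPath (fun i hi => by
          rw [hp2 i hi.le, hp2 n le_rfl]; exact h2 i hi) hp3
        have hup : p.2 ∈ upTransient d := by
          refine ⟨fun s hs => ?_, shiftPath_mem_transientPaths_iff.1 hp3.2⟩
          by_cases hsn : s ≤ n
          · rw [hp2 s hsn, hp2 0 (Nat.zero_le n)]
            exact h3 s hs hsn
          · exact (hn.1 0 h1).trans (hn.2 s (by omega))
        have hr : regTime p.2 1 = n := regTime_one_eq (isRegenerationTime_zero hup) hn h1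
          fun k hk hreg => h4 k hk ((isRegenerationTime_iff_upTo hp2 hn hk.le).1 hreg)
        refine ⟨⟨hup, ⟨n, h1, hn⟩, ?_⟩, hr, hp2⟩
        rw [slabOf_eq_finiteSlab hp2 (regTime_zero_of_upTransient hup) hr]
        exact hp1
  have h1 := key MeasurableSet.univ
  simp only [Set.mem_univ, and_true, measure_univ, mul_one] at h1
  have h2 : upLaw Q {p | slabOf p ∈ B} = slabLaw Q B := by
    rw [slabLaw_eq_map_upLaw Q hA, Measure.map_apply measurable_slabOf hB]
    rfl
  have h3 := key hG
  rw [← h1, h2, mul_assoc] at h3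
  exact (ENNReal.mul_right_inj (jointLaw_upTransient_pos Q hA).ne' (measure_ne_top _ _)).1 h3

/-- The successive regeneration slabs. -/
def slabSeq (p : Env d × Path d) (k : ℕ) : Slab d := slabOf (nextPair^[k] p)

theorem measurable_slabSeq : Measurable (slabSeq (d := d)) :=
  measurable_pi_lambda _ fun k => measurable_slabOf.comp (measurable_nextPair.iterate k)

/-- The successive regeneration slabs are i.i.d. -/
theorem upLaw_map_slabSeq
    (hA : 0 < jointLaw (envLaw Q) 0 (Prod.snd ⁻¹' transientPaths d)) :
    haveI := isProbabilityMeasure_slabLaw Q hA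
    (upLaw Q).map slabSeq = Measure.infinitePi fun _ : ℕ => slabLaw Q := by
  have hupLaw := isProbabilityMeasure_upLaw Q hA
  have hslab := isProbabilityMeasure_slabLaw Q hA
  -- The induction peels off the first slab: the remaining ones are the slabs of `nextPair p`, which
  -- is independent of it and again has law `upLaw Q`.
  have key : ∀ (N : ℕ) (t : ℕ → Set (Slab d)), (∀ k, MeasurableSet (t k)) →
      upLaw Q {p | ∀ k < N, slabSeq p k ∈ t k} = ∏ k ∈ range N, slabLaw Q (t k) := by
    intro N
    induction N with
    | zero => intro t _; simp
    | succ N ih =>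
      intro t ht
      have hm : MeasurableSet {p : Env d × Path d | ∀ k < N, slabSeq p k ∈ t (k + 1)} := by
        have : {p : Env d × Path d | ∀ k < N, slabSeq p k ∈ t (k + 1)} =
            ⋂ k : ℕ, ⋂ _ : k < N, (fun p => slabSeq p k) ⁻¹' t (k + 1) := by
          ext p; simp
        rw [this]
        exact MeasurableSet.iInter fun k => MeasurableSet.iInter fun _ =>
          ((measurable_pi_apply k).comp measurable_slabSeq) (ht _)
      have hset : {p : Env d × Path d | ∀ k < N + 1, slabSeq p k ∈ t k} =
          {p | slabOf p ∈ t 0 ∧ nextPair p ∈ {p | ∀ k < N, slabSeq p k ∈ t (k + 1)}} := by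
        ext p
        constructor
        · exact fun h => ⟨h 0 (Nat.succ_pos N), fun k hk => h (k + 1) (Nat.succ_lt_succ hk)⟩
        · rintro ⟨h1, h2⟩ k hk
          rcases k with _ | k
          · exact h1
          · exact h2 k (Nat.lt_of_succ_lt_succ hk)
      rw [hset, upLaw_slabOf_nextPair Q hA (ht 0) hm, ih _ fun k => ht (k + 1),
        prod_range_succ', mul_comm]
  classical
  refine Measure.eq_infinitePi _ fun s t ht => ?_
  rw [Measure.map_apply measurable_slabSeq (MeasurableSet.pi s.countable_toSet fun i _ => ht i)]
  have hs : s ⊆ range (s.sup id + 1) := fun k hk =>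
    mem_range.2 (Nat.lt_succ_of_le (le_sup (f := id) hk))
  have h1 : slabSeq ⁻¹' (s : Set ℕ).pi t = {p : Env d × Path d | ∀ k < s.sup id + 1,
      slabSeq p k ∈ if k ∈ s then t k else Set.univ} := by
    ext p
    constructor
    · intro h k _
      split_ifs with hk
      · exact h k hk
      · trivial
    · intro h k hk
      have := h k (mem_range.1 (hs hk))
      rwa [if_pos (Finset.mem_coe.1 hk)] at this
  rw [h1, key _ _ fun k => by split_ifs; exacts [ht k, MeasurableSet.univ],
    ← prod_subset hs]
  · exact prod_congr rfl fun k hk => by rw [if_pos hk]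
  · intro k _ hk
    rw [if_neg hk, measure_univ]

end UpLaw


/-! ### Gluing slabs -/

/-- A sequence of slabs, extended to negative indices by repeating its first element. -/
def extendSeq {d : ℕ} (s : ℕ → Slab d) (n : ℤ) : Slab d := s n.toNat

theorem measurable_extendSeq {d : ℕ} : Measurable (extendSeq (d := d)) :=
  measurable_pi_lambda _ fun n => measurable_pi_apply n.toNat

section Glue

variable {d : ℕ} [NeZero d]

/-- The slab has positive width and its path leads from the bottom to the top of the slab. -/
def Slab.IsCrossing (S : Slab d) : Prop := 1 ≤ S.L ∧ level (S.K S.u) = S.L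

theorem inSlab_iff {S : ℤ → Slab d} (hS : ∀ n, (S n).IsCrossing) (z : Lattice d) (n : ℤ) :
    InSlab S z n ↔ level (gluePoint S n) ≤ level z ∧ level z < level (gluePoint S (n + 1)) := by
  rw [gluePoint_add_one, level_add, (hS n).2]
  simp only [InSlab, slabSites, Set.mem_ofPred_eq, level_sub]
  constructor <;> rintro ⟨h1, h2⟩ <;> constructor <;> omega

theorem strictMono_level_gluePoint {S : ℤ → Slab d} (hS : ∀ n, (S n).IsCrossing) :
    StrictMono fun n => level (gluePoint S n) := by
  refine strictMono_int_of_lt_succ fun n => ?_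
  rw [gluePoint_add_one, level_add, (hS n).2]
  have := (hS n).1
  omega

/-- The levels of the gluing points increase by at least 1 per slab, hence are unbounded in both
directions and cut the integers into consecutive intervals. The slab of `z` has the largest index
whose bottom is at most the level of `z`. -/
theorem existsUnique_inSlab {S : ℤ → Slab d} (hS : ∀ n, (S n).IsCrossing) (z : Lattice d) :
    ∃! n, InSlab S z n := by
  have hmono := strictMono_level_gluePoint hS
  have h0 : level (gluePoint S 0) = 0 := by rw [gluePoint_zero]; rfl
  have hup : ∀ n : ℕ, (n : ℤ) ≤ level (gluePoint S n) := fun n => by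
    induction n with
    | zero => exact h0.ge
    | succ n ih =>
      have := hmono (show (n : ℤ) < (n + 1 : ℕ) by push_cast; omega)
      push_cast at this ⊢
      omega
  have hdown : ∀ n : ℕ, level (gluePoint S (-n)) ≤ -(n : ℤ) := fun n => by
    induction n with
    | zero => simpa using h0.le
    | succ n ih =>
      have := hmono (show (-(n + 1 : ℕ) : ℤ) < -n by push_cast; omega)
      push_cast at this ⊢
      omega
  obtain ⟨n, hn, hmax⟩ := Int.exists_greatest_of_bdd
    (P := fun n => level (gluePoint S n) ≤ level z)
    ⟨(level z).toNat + 1, fun n hn => by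
      by_contra hlt
      have h1 := hup ((level z).toNat + 1)
      have h2 := hmono.monotone (not_le.1 hlt).le
      push_cast at h1
      omega⟩
    ⟨-((-level z).toNat : ℤ), (hdown _).trans (by omega)⟩
  refine ⟨n, (inSlab_iff hS z n).2 ⟨hn, not_le.1 fun h => ?_⟩, fun m (hm : InSlab S z m) => ?_⟩
  · have := hmax (n + 1) h
    omega
  · rw [inSlab_iff hS] at hm
    refine le_antisymm (hmax m hm.1) (not_lt.1 fun h => ?_)
    have := hmono.monotone (show m + 1 ≤ n by omega)
    omega

theorem glueEnv_apply {S : ℤ → Slab d} (hS : ∀ n, (S n).IsCrossing) {z : Lattice d} {n : ℤ}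
    (hn : InSlab S z n) : glueEnv S z = (S n).W (z - gluePoint S n) := by
  have h := existsUnique_inSlab hS z
  rw [glueEnv, dif_pos h, h.unique h.choose_spec.1 hn]

theorem nonneg_of_inSlab {S : ℤ → Slab d} (hS : ∀ n, (S n).IsCrossing) {z : Lattice d} {n : ℤ}
    (hn : InSlab S z n) (hz : 0 ≤ level z) : 0 ≤ n := by
  by_contra hlt
  have h1 := (strictMono_level_gluePoint hS).monotone (show n + 1 ≤ 0 by omega)
  have h2 := ((inSlab_iff hS z n).1 hn).2
  simp only [gluePoint_zero, level_zero] at h1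
  omega

theorem gluePoint_of_shift {d : ℕ} {S T : ℤ → Slab d} {N : ℕ} (hST : ∀ k : ℕ, T k = S (k - N)) (k : ℕ) :
    gluePoint S (k - N) = gluePoint S (-N) + gluePoint T k := by
  induction k with
  | zero => simp [gluePoint_zero]
  | succ k ih =>
    have h : ((k + 1 : ℕ) : ℤ) - N = ((k : ℤ) - N) + 1 := by push_cast; ring
    rw [h, gluePoint_add_one, ih, Nat.cast_succ, gluePoint_add_one, hST k, add_assoc]

/-- `T` agrees with the shift of `S` only at nonnegative indices; sites of nonnegative level lie in
slabs with such indices, so the other slabs of `T` play no role. -/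
theorem glueEnv_of_shift {S T : ℤ → Slab d} (hS : ∀ n, (S n).IsCrossing)
    (hT : ∀ n, (T n).IsCrossing) {N : ℕ} (hST : ∀ k : ℕ, T k = S (k - N)) {z : Lattice d}
    (hz : 0 ≤ level z) : glueEnv T z = glueEnv S (z + gluePoint S (-N)) := by
  obtain ⟨n, hn, -⟩ := existsUnique_inSlab hT z
  obtain ⟨k, rfl⟩ := Int.eq_ofNat_of_zero_le (nonneg_of_inSlab hT hn hz)
  have h1 : z + gluePoint S (-N) - gluePoint S (k - N) = z - gluePoint T k := by
    rw [gluePoint_of_shift hST]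
    abel
  have h2 : InSlab S (z + gluePoint S (-N)) (k - N) := by
    rw [InSlab, h1, ← hST k]
    exact hn
  rw [glueEnv_apply hT hn, glueEnv_apply hS h2, h1, hST k]

/-! ### Escape inside the upper half-space. -/

/-- The trajectories which are transient in the direction `ℓ` and stay at nonnegative levels. -/
def upperTransient (d : ℕ) [NeZero d] : Set (Path d) :=
  {X | ∀ i, 0 ≤ level (X i)} ∩ transientPaths d

theorem measurableSet_upperTransient : MeasurableSet (upperTransient d) := by
  refine MeasurableSet.inter ?_ measurableSet_transientPaths
  have h : {X : Path d | ∀ i, 0 ≤ level (X i)} = ⋂ i : ℕ, {X | 0 ≤ level (X i)} := by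
    ext X; simp
  rw [h]
  exact MeasurableSet.iInter fun i => measurableSet_le measurable_const (measurable_level_apply i)

theorem quenchedLaw_upperTransient_congr {ω ω' : Env d} (h : ∀ x, 0 ≤ level x → ω x = ω' x)
    (z : Lattice d) : quenchedLaw ω z (upperTransient d) = quenchedLaw ω' z (upperTransient d) :=
  quenchedLaw_inter_congr {x | 0 ≤ level x} h z measurableSet_upperTransient fun _ hX => hX.1

/-- Seen from the bottom of the slab `-N` of `S`, the origin is the bottom of the slab `N` of `T`. A
walk that never goes below that bottom does not distinguish the two environments, and dropping this
restriction only increases the probability. -/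
theorem quenchedLaw_glueEnv_le_of_shift {S T : ℤ → Slab d} (hS : ∀ n, (S n).IsCrossing)
    (hT : ∀ n, (T n).IsCrossing) {N : ℕ} (hST : ∀ k : ℕ, T k = S (k - N)) :
    quenchedLaw (glueEnv T) (gluePoint T N) (upperTransient d) ≤
      quenchedLaw (glueEnv S) 0 (transientPaths d) := by
  have h0 : gluePoint T N + gluePoint S (-N) = 0 := by
    have := gluePoint_of_shift hST N
    rw [sub_self, gluePoint_zero] at this
    rw [add_comm, ← this]
  rw [quenchedLaw_upperTransient_congr
      (ω' := shiftEnv (gluePoint S (-N)) (glueEnv S)) fun x hx => glueEnv_of_shift hS hT hST hx,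
    quenchedLaw_shiftEnv, h0,
    Measure.map_apply (measurable_subPath _) measurableSet_upperTransient]
  exact measure_mono fun X hX => subPath_mem_transientPaths_iff.1 hX.2

/-- The probability that the walk in the environment glued from the sequence `s`, started at the
bottom of the slab with index `N`, is transient in the direction `ℓ` and never leaves the glued
slabs. -/
def escapeProb (N : ℕ) (s : ℕ → Slab d) : ENNReal :=
  quenchedLaw (glueEnv (extendSeq s)) (gluePoint (extendSeq s) N) (upperTransient d)

theorem measurable_glueEnv : Measurable (glueEnv (d := d)) := measurable_glue.fst

theorem measurable_escapeProb (N : ℕ) : Measurable (escapeProb (d := d) N) :=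
  measurable_eval_countable
    (f := fun s z => quenchedLaw (glueEnv (extendSeq s)) z (upperTransient d))
    (g := fun s => gluePoint (extendSeq s) N)
    (measurable_pi_lambda _ fun z =>
      (measurable_quenchedLaw_apply z measurableSet_upperTransient).comp
        (measurable_glueEnv.comp measurable_extendSeq))
    ((measurable_gluePoint (N : ℤ)).comp measurable_extendSeq)

end Glue

/-! ### The slabs of a walk which regenerates infinitely often -/

section SlabSeq

variable {d : ℕ} [NeZero d]

theorem IsRegenerating.iterate {p : Env d × Path d} (h : IsRegenerating p) (n : ℕ) :
    IsRegenerating (RWRE.nextPair^[n] p) := by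
  induction n with
  | zero => exact h
  | succ n ih =>
    rw [Function.iterate_succ_apply']
    exact ih.nextPair

theorem IsRegenerating.slabOf_L {p : Env d × Path d} (h : IsRegenerating p) :
    (slabOf p).L = level (p.2 (regTime p.2 1)) := by
  simp [slabOf, firstSlab, regTime_zero_of_upTransient h.2.1, h.1, level_zero]

theorem IsRegenerating.slabOf_K {p : Env d × Path d} (h : IsRegenerating p) :
    (slabOf p).K (slabOf p).u = p.2 (regTime p.2 1) := by
  simp [slabOf, firstSlab, regTime_zero_of_upTransient h.2.1, h.1]

theorem IsRegenerating.slabOf_W {p : Env d × Path d} (h : IsRegenerating p) {z : Lattice d}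
    (hz : z ∈ slabSites d (slabOf p).L) : (slabOf p).W z = p.1 z := by
  rw [slabOf_W_of_mem hz, regTime_zero_of_upTransient h.2.1, h.1, add_zero]

theorem IsRegenerating.isCrossing {p : Env d × Path d} (h : IsRegenerating p) :
    (slabOf p).IsCrossing := by
  obtain ⟨h1, h2, -⟩ := h.regTime_one
  have h3 := h2.1 0 h1
  rw [h.1, level_zero] at h3
  refine ⟨?_, ?_⟩
  · rw [h.slabOf_L]
    omega
  · rw [h.slabOf_L, h.slabOf_K]

theorem IsRegenerating.isCrossing_extendSeq {p : Env d × Path d} (h : IsRegenerating p) (n : ℤ) :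
    (extendSeq (slabSeq p) n).IsCrossing :=
  (h.iterate _).isCrossing

/-- The end of the slab with index `N - 1`, in the time of the original walk. -/
def slabTime (p : Env d × Path d) (N : ℕ) : ℕ :=
  ∑ k ∈ range N, regTime (nextPair^[k] p).2 1

theorem IsRegenerating.le_slabTime {p : Env d × Path d} (h : IsRegenerating p) (N : ℕ) :
    N ≤ slabTime p N := by
  have := card_nsmul_le_sum (range N) (fun k => regTime (RWRE.nextPair^[k] p).2 1) 1
    fun k _ => (h.iterate k).regTime_one.1
  rw [card_range, smul_eq_mul, mul_one] at this
  exact this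

/-- Successive recentrings compose to a single one at `slabTime p N`; the gluing points are the
positions of the original walk at these times. -/
theorem IsRegenerating.iterate_nextPair_eq {p : Env d × Path d} (h : IsRegenerating p) (N : ℕ) :
    (RWRE.nextPair^[N] p).2 = subPath (p.2 (slabTime p N)) (shiftPath (slabTime p N) p.2) ∧
    (∀ x, 0 ≤ level x → (RWRE.nextPair^[N] p).1 x = p.1 (x + p.2 (slabTime p N))) ∧
    gluePoint (extendSeq (slabSeq p)) N = p.2 (slabTime p N) := by
  induction N with
  | zero =>
    refine ⟨?_, fun x _ => ?_, ?_⟩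
    · funext i
      simp [slabTime, subPath, shiftPath, h.1]
    · simp [slabTime, h.1]
    · rw [Nat.cast_zero, gluePoint_zero]
      simp [slabTime, h.1]
  | succ N ih =>
    obtain ⟨ih1, ih2, ih3⟩ := ih
    have hq := h.iterate N
    set q := RWRE.nextPair^[N] p with hqdef
    obtain ⟨h1, h2, -⟩ := hq.regTime_one
    have hlev := h2.1 0 h1
    rw [hq.1, level_zero] at hlev
    have ht : slabTime p (N + 1) = slabTime p N + regTime q.2 1 := sum_range_succ _ _
    have hqr : ∀ i, q.2 i = p.2 (slabTime p N + i) - p.2 (slabTime p N) := fun i => by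
      rw [ih1]; rfl
    rw [Function.iterate_succ_apply', ← hqdef, ht]
    refine ⟨?_, fun x hx => ?_, ?_⟩
    · funext i
      simp only [RWRE.nextPair, recenter, subPath, shiftPath, hqr, sub_sub_sub_cancel_right,
        add_assoc]
    · have h3 : (RWRE.nextPair q).1 x = q.1 (x + q.2 (regTime q.2 1)) := if_pos hx
      rw [h3, ih2 _ (by rw [level_add]; omega), hqr, add_assoc, sub_add_cancel]
    · have h3 : extendSeq (slabSeq p) N = slabOf q := rfl
      rw [Nat.cast_succ, gluePoint_add_one, ih3, h3, hq.slabOf_K, hqr]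
      abel

/-- The slabs of the walk tile the upper half-space, and each records the original environment up to
translation by its gluing point. -/
theorem IsRegenerating.glueEnv_eq {p : Env d × Path d} (h : IsRegenerating p) {z : Lattice d}
    (hz : 0 ≤ level z) : glueEnv (extendSeq (slabSeq p)) z = p.1 z := by
  obtain ⟨n, hn, -⟩ := existsUnique_inSlab h.isCrossing_extendSeq z
  obtain ⟨k, rfl⟩ := Int.eq_ofNat_of_zero_le (nonneg_of_inSlab h.isCrossing_extendSeq hn hz)
  obtain ⟨-, h2, h3⟩ := h.iterate_nextPair_eq k
  rw [glueEnv_apply h.isCrossing_extendSeq hn]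
  have h4 : extendSeq (slabSeq p) k = slabOf (RWRE.nextPair^[k] p) := rfl
  rw [InSlab] at hn
  simp only [h4] at hn ⊢
  rw [(h.iterate k).slabOf_W hn, h2 _ hn.1, h3, sub_add_cancel]

theorem IsRegenerating.escapeProb_eq {p : Env d × Path d} (h : IsRegenerating p) (N : ℕ) :
    escapeProb N (slabSeq p) = quenchedLaw p.1 (p.2 (slabTime p N)) (upperTransient d) := by
  rw [escapeProb, quenchedLaw_upperTransient_congr fun x hx => h.glueEnv_eq hx,
    (h.iterate_nextPair_eq N).2.2]

theorem slabSeq_upperPart {p : Env d × Path d} (h : IsRegenerating p) :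
    slabSeq (upperPart p) = slabSeq p := by
  funext k
  rcases k with _ | k
  · exact slabOf_upperPart h
  · simp only [slabSeq, Function.iterate_succ_apply, nextPair_upperPart h]

/-- On the event of transience above the level `0`, the quenched probability of this event from
the current position tends to `1`. -/
theorem ae_tendsto_quenchedLaw_upperTransient (ω : Env d) (z : Lattice d) :
    ∀ᵐ X ∂quenchedLaw ω z, X ∈ upperTransient d →
      Tendsto (fun n => quenchedLaw ω (X n) (upperTransient d)) atTop (nhds 1) := by
  have h1 : ∀ᵐ X ∂quenchedLaw ω z, ∀ k : ℕ, X ∈ upperTransient d → ∀ᶠ n in atTop,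
      (1 - 1 / ((k : ℝ) + 1)) * (quenchedLaw ω z).real (cyl n X) <
        (quenchedLaw ω z).real (upperTransient d ∩ cyl n X) :=
    ae_all_iff.2 fun k => ae_lt_measureReal_inter_cyl _ measurableSet_upperTransient
      (sub_lt_self _ (by positivity))
  filter_upwards [h1] with X hX hXU
  refine tendsto_order.2 ⟨fun a ha => ?_, fun a ha => Eventually.of_forall fun n =>
    prob_le_one.trans_lt ha⟩
  have ha' : a.toReal < 1 := by
    simpa using (ENNReal.toReal_lt_toReal (ha.trans ENNReal.one_lt_top).ne ENNReal.one_ne_top).2 ha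
  obtain ⟨k, hk⟩ := exists_nat_one_div_lt (sub_pos.2 ha')
  filter_upwards [hX k hXU] with n hn
  have h2 : (quenchedLaw ω z).real (upperTransient d ∩ cyl n X) ≤
      (quenchedLaw ω z).real (cyl n X) * (quenchedLaw ω (X n)).real (upperTransient d) := by
    -- The future of a trajectory in the event is again in the event. So the conditional probability
    -- in Lévy's law is at most the quenched probability from `X n`.
    have h3 : upperTransient d ∩ cyl n X ⊆ cyl n X ∩ shiftPath n ⁻¹' upperTransient d :=
      fun Y hY => ⟨hY.2, fun i => hY.1.1 (n + i), shiftPath_mem_transientPaths_iff.2 hY.1.2⟩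
    refine (measureReal_mono h3 (measure_ne_top _ _)).trans_eq ?_
    rw [Measure.real, quenchedLaw_markov _ _ _ _ measurableSet_upperTransient, ENNReal.toReal_mul]
    rfl
  have h4 : a.toReal < (quenchedLaw ω (X n)).real (upperTransient d) := by
    have h5 : (0 : ℝ) ≤ (quenchedLaw ω z).real (cyl n X) := measureReal_nonneg
    by_contra hle
    nlinarith
  exact (ENNReal.toReal_lt_toReal (ha.trans ENNReal.one_lt_top).ne (measure_ne_top _ _)).1 h4

end SlabSeq

/-! ### Transience in the glued environment -/

section Conclusion

variable {d : ℕ} [NeZero d] (Q : Measure (StepLaw d)) [IsProbabilityMeasure Q]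

theorem ae_cond_isRegenerating
    (hA : 0 < jointLaw (envLaw Q) 0 (Prod.snd ⁻¹' transientPaths d)) :
    ∀ᵐ p ∂cond (jointLaw (envLaw Q) 0) (Prod.snd ⁻¹' upTransient d), IsRegenerating p := by
  filter_upwards [ae_cond_mem (measurable_snd measurableSet_upTransient),
    cond_absolutelyContinuous.ae_le (ae_isRegenerating Q hA)] with p h1 h2 using h2 h1

/-- The quenched zero-one statement holds for every environment. Read along the times `slabTime p
N`, which tend to infinity, it is a statement about `escapeProb N`. -/
theorem ae_cond_tendsto_escapeProb
    (hA : 0 < jointLaw (envLaw Q) 0 (Prod.snd ⁻¹' transientPaths d)) :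
    ∀ᵐ p ∂cond (jointLaw (envLaw Q) 0) (Prod.snd ⁻¹' upTransient d),
      Tendsto (fun N => escapeProb N (slabSeq (upperPart p))) atTop (nhds 1) := by
  have hm : MeasurableSet {p : Env d × Path d | p.2 ∈ upperTransient d →
      Tendsto (fun n => quenchedLaw p.1 (p.2 n) (upperTransient d)) atTop (nhds 1)} := by
    have h1 : ∀ n, Measurable fun p : Env d × Path d =>
        quenchedLaw p.1 (p.2 n) (upperTransient d) := fun n =>
      measurable_eval_countable
        (f := fun (p : Env d × Path d) z => quenchedLaw p.1 z (upperTransient d))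
        (g := fun p => p.2 n)
        (measurable_pi_lambda _ fun z =>
          (measurable_quenchedLaw_apply z measurableSet_upperTransient).comp measurable_fst)
        ((measurable_path_apply n).comp measurable_snd)
    have h2 : {p : Env d × Path d | p.2 ∈ upperTransient d →
        Tendsto (fun n => quenchedLaw p.1 (p.2 n) (upperTransient d)) atTop (nhds 1)} =
        (Prod.snd ⁻¹' upperTransient d)ᶜ ∪ {p : Env d × Path d |
          Tendsto (fun n => quenchedLaw p.1 (p.2 n) (upperTransient d)) atTop (nhds 1)} := by
      ext p
      exact imp_iff_not_or
    rw [h2]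
    exact (measurable_snd measurableSet_upperTransient).compl.union (measurableSet_tendsto _ h1)
  have h1 : ∀ᵐ p ∂jointLaw (envLaw Q) 0, p.2 ∈ upperTransient d →
      Tendsto (fun n => quenchedLaw p.1 (p.2 n) (upperTransient d)) atTop (nhds 1) :=
    (Measure.ae_compProd_iff hm).2 (Eventually.of_forall fun ω =>
      ae_tendsto_quenchedLaw_upperTransient ω 0)
  filter_upwards [ae_cond_isRegenerating Q hA, cond_absolutelyContinuous.ae_le h1] with p hp h2
  have h3 : p.2 ∈ upperTransient d := by
    refine ⟨fun i => ?_, hp.2.1.2⟩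
    rcases Nat.eq_zero_or_pos i with rfl | hi
    · rw [hp.1, level_zero]
    · have := hp.2.1.1 i hi
      rw [hp.1, level_zero] at this
      exact this.le
  simp_rw [slabSeq_upperPart hp, hp.escapeProb_eq]
  exact (h2 h3).comp (tendsto_atTop_mono hp.le_slabTime tendsto_id)

theorem tendsto_lintegral_escapeProb
    (hA : 0 < jointLaw (envLaw Q) 0 (Prod.snd ⁻¹' transientPaths d)) :
    haveI := isProbabilityMeasure_slabLaw Q hA
    Tendsto (fun N => ∫⁻ s, escapeProb N s ∂Measure.infinitePi fun _ : ℕ => slabLaw Q) atTop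
      (nhds 1) := by
  have hslab := isProbabilityMeasure_slabLaw Q hA
  have hcond := cond_isProbabilityMeasure (jointLaw_upTransient_pos Q hA).ne'
  have h1 : ∀ N, ∫⁻ s, escapeProb N s ∂(Measure.infinitePi fun _ : ℕ => slabLaw Q) =
      ∫⁻ p, escapeProb N (slabSeq (upperPart p))
        ∂cond (jointLaw (envLaw Q) 0) (Prod.snd ⁻¹' upTransient d) := fun N => by
    rw [← upLaw_map_slabSeq Q hA, lintegral_map (measurable_escapeProb N) measurable_slabSeq,
      upLaw, lintegral_map (f := fun p => escapeProb N (slabSeq p)) ((measurable_escapeProb N).comp measurable_slabSeq)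
        measurable_upperPart]
  simp_rw [h1]
  have h2 := tendsto_lintegral_of_dominated_convergence (fun _ => (1 : ENNReal))
    (fun N => ((measurable_escapeProb N).comp measurable_slabSeq).comp measurable_upperPart)
    (fun N => Eventually.of_forall fun p => prob_le_one) (by simp)
    (ae_cond_tendsto_escapeProb Q hA)
  simpa using h2

theorem infinitePi_map_sub {d : ℕ} (Λ : Measure (Slab d)) [IsProbabilityMeasure Λ] (N : ℕ) :
    (Measure.infinitePi fun _ : ℤ => Λ).map (fun S (k : ℕ) => S (k - N)) =
      Measure.infinitePi fun _ : ℕ => Λ := by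
  refine Measure.eq_infinitePi _ fun s t ht => ?_
  have hm : Measurable fun (S : ℤ → Slab d) (k : ℕ) => S (k - N) :=
    measurable_pi_lambda _ fun k => measurable_pi_apply _
  rw [Measure.map_apply hm (MeasurableSet.pi s.countable_toSet fun i _ => ht i)]
  -- Reindexing by this injection turns a one-sided cylinder into a two-sided one; `(n + N).toNat`
  -- inverts it on its range.
  let e : ℕ ↪ ℤ := ⟨fun k => k - N, fun a b h => by simpa using h⟩
  have he : ∀ k, e k = k - N := fun _ => rfl
  have h : (fun (S : ℤ → Slab d) (k : ℕ) => S (k - N)) ⁻¹' Set.pi (s : Set ℕ) t =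
      Set.pi ((s.map e : Finset ℤ) : Set ℤ) fun n : ℤ => t (n + N).toNat := by
    ext S
    simp [Set.mem_pi, he]
  rw [h, Measure.infinitePi_pi _ fun i _ => ht _, prod_map]
  simp [he]

/-! ### Ellipticity, stationarity and the change of starting point. -/

/-- The slab environment gives positive probability to every step. -/
def Slab.IsElliptic (S : Slab d) : Prop :=
  ∀ z ∈ slabSites d S.L, ∀ e : Step d, (S.W z).toMeasure {e} ≠ 0

theorem measurableSet_isCrossing : MeasurableSet {S : Slab d | S.IsCrossing} := by
  have h := measurable_slab (d := d)
  exact (measurableSet_le measurable_const h.fst).inter (measurableSet_eq_fun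
    (measurable_level.comp (measurable_eval_countable h.snd.snd.snd h.snd.snd.fst)) h.fst)

theorem measurableSet_isElliptic : MeasurableSet {S : Slab d | S.IsElliptic} := by
  have h := measurable_slab (d := d)
  have h1 : {S : Slab d | S.IsElliptic} = ⋂ z : Lattice d, ⋂ e : Step d,
      {S : Slab d | z ∈ slabSites d S.L}ᶜ ∪ {S : Slab d | (S.W z).toMeasure {e} ≠ 0} := by
    ext S
    simp only [Slab.IsElliptic, Set.mem_iInter, Set.mem_union, Set.mem_compl_iff,
      Set.mem_ofPred_eq]
    exact ⟨fun h z e => imp_iff_not_or.1 fun hz => h z hz e,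
      fun h z hz e => imp_iff_not_or.2 (h z e) hz⟩
  have hcount : Countable (Step d) := inferInstance
  rw [h1]
  refine MeasurableSet.iInter fun z => MeasurableSet.iInter fun e =>
    (measurableSet_slabSites h.fst measurable_const).compl.union ?_
  have h2 : Measurable fun S : Slab d => (S.W z).toMeasure {e} :=
    (Measure.measurable_coe (measurableSet_singleton e)).comp
      (measurable_subtype_coe.comp ((measurable_env_apply z).comp h.snd.fst))
  exact (h2 (measurableSet_singleton 0)).compl

theorem ae_envLaw_elliptic {d : ℕ} (Q : Measure (StepLaw d)) [IsProbabilityMeasure Q]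
    (hQ : UniformlyElliptic Q) :
    ∀ᵐ ω ∂envLaw Q, ∀ (x : Lattice d) (e : Step d), (ω x).toMeasure {e} ≠ 0 := by
  obtain ⟨ε, hε, hQε⟩ := hQ
  refine ae_all_iff.2 fun x => ?_
  have h1 : ∀ᵐ q ∂Q, ∀ e : Step d, q.toMeasure {e} ≠ 0 := by
    refine ae_all_iff.2 fun e => ?_
    refine measure_mono_null (fun q hq => ?_) (hQε e)
    have hq' : q.toMeasure {e} = 0 := not_not.1 hq
    change q {e} < ε
    rwa [(ProbabilityMeasure.null_iff_toMeasure_null q {e}).2 hq']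
  exact (measurePreserving_eval_infinitePi (fun _ : Lattice d => Q) x).quasiMeasurePreserving.ae h1

theorem ae_slabLaw (hQ : UniformlyElliptic Q)
    (hA : 0 < jointLaw (envLaw Q) 0 (Prod.snd ⁻¹' transientPaths d)) :
    ∀ᵐ S ∂slabLaw Q, S.IsCrossing ∧ S.IsElliptic := by
  rw [slabLaw_eq_map_upLaw Q hA, upLaw, Measure.map_map measurable_slabOf measurable_upperPart,
    ae_map_iff (p := fun S : Slab d => S.IsCrossing ∧ S.IsElliptic)
      (measurable_slabOf.comp measurable_upperPart).aemeasurable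
      (measurableSet_isCrossing.inter measurableSet_isElliptic)]
  have h1 : ∀ᵐ p ∂jointLaw (envLaw Q) 0,
      ∀ (x : Lattice d) (e : Step d), (p.1 x).toMeasure {e} ≠ 0 :=
    ae_of_ae_map (f := Prod.fst) measurable_fst.aemeasurable (by
      have h : (jointLaw (envLaw Q) 0).map Prod.fst = envLaw Q := Measure.fst_compProd _ _
      rw [h]
      exact ae_envLaw_elliptic Q hQ)
  filter_upwards [ae_cond_isRegenerating Q hA, cond_absolutelyContinuous.ae_le h1] with p hp h2
  rw [Function.comp_apply, slabOf_upperPart hp]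
  refine ⟨hp.isCrossing, fun z hz e => ?_⟩
  rw [hp.slabOf_W hz]
  exact h2 z e

/-- The mean probability of transience from 0 bounds the mean of `escapeProb N` for all `N`, and
these means tend to 1. A quantity at most 1 with mean at least 1 equals 1 almost surely. -/
theorem ae_glueEnv_transient_zero (hQ : UniformlyElliptic Q)
    (hA : 0 < jointLaw (envLaw Q) 0 (Prod.snd ⁻¹' transientPaths d)) :
    haveI := isProbabilityMeasure_slabLaw Q hA
    ∀ᵐ S ∂Measure.infinitePi fun _ : ℤ => slabLaw Q,
      quenchedLaw (glueEnv S) 0 (transientPaths d)ᶜ = 0 := by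
  have hslab := isProbabilityMeasure_slabLaw Q hA
  set Λ := Measure.infinitePi fun _ : ℤ => slabLaw Q with hΛ
  have hgood : ∀ᵐ S ∂Λ, ∀ n, (S n).IsCrossing := ae_all_iff.2 fun n =>
    (measurePreserving_eval_infinitePi (fun _ : ℤ => slabLaw Q) n).quasiMeasurePreserving.ae
      ((ae_slabLaw Q hQ hA).mono fun _ h => h.1)
  have hm : Measurable fun S : ℤ → Slab d => quenchedLaw (glueEnv S) 0 (transientPaths d) :=
    (measurable_quenchedLaw_apply 0 measurableSet_transientPaths).comp measurable_glueEnv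
  have h1 : ∀ N : ℕ, ∫⁻ s, escapeProb N s ∂(Measure.infinitePi fun _ : ℕ => slabLaw Q) ≤
      ∫⁻ S, quenchedLaw (glueEnv S) 0 (transientPaths d) ∂Λ := fun N => by
    have hsub : Measurable fun (S : ℤ → Slab d) (k : ℕ) => S (k - N) :=
      measurable_pi_lambda _ fun k => measurable_pi_apply _
    rw [← infinitePi_map_sub (slabLaw Q) N, lintegral_map (measurable_escapeProb N) hsub]
    refine lintegral_mono_ae ?_
    filter_upwards [hgood] with S hS
    exact quenchedLaw_glueEnv_le_of_shift (T := extendSeq fun k : ℕ => S (k - N)) hS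
      (fun n => hS _) fun k => rfl
  have h2 : (1 : ENNReal) ≤ ∫⁻ S, quenchedLaw (glueEnv S) 0 (transientPaths d) ∂Λ :=
    le_of_tendsto (tendsto_lintegral_escapeProb Q hA) (Eventually.of_forall h1)
  have h3 : ∫⁻ S, quenchedLaw (glueEnv S) 0 (transientPaths d)ᶜ ∂Λ = 0 := by
    have h4 : ∀ S : ℤ → Slab d, quenchedLaw (glueEnv S) 0 (transientPaths d)ᶜ =
        1 - quenchedLaw (glueEnv S) 0 (transientPaths d) := fun S =>
      prob_compl_eq_one_sub measurableSet_transientPaths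
    simp_rw [h4]
    rw [lintegral_sub hm (ne_top_of_le_ne_top ENNReal.one_ne_top
      ((lintegral_mono fun S => prob_le_one).trans (by simp)))
      (Eventually.of_forall fun S => prob_le_one)]
    simpa [tsub_eq_zero_iff_le] using h2
  rw [lintegral_eq_zero_iff (f := fun S => quenchedLaw (glueEnv S) 0 (transientPaths d)ᶜ) ((measurable_quenchedLaw_apply 0
    measurableSet_transientPaths.compl).comp measurable_glueEnv)] at h3
  exact h3

theorem lattice_induction {d : ℕ} {p : Lattice d → Prop} (h0 : p 0)
    (hstep : ∀ x, p x → ∀ e : Step d, p (x + e)) (z : Lattice d) : p z := by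
  have h1 : ∀ (i : Fin d) (k : ℤ) (x : Lattice d), p x → p (x + Pi.single i k) := by
    intro i k
    induction k using Int.induction_on with
    | zero => intro x hx; simpa using hx
    | succ k ih =>
      intro x hx
      rw [Pi.single_add, ← add_assoc]
      exact hstep _ (ih x hx) ⟨Pi.single i 1, i, Or.inl rfl⟩
    | pred k ih =>
      intro x hx
      rw [sub_eq_add_neg, Pi.single_add, ← add_assoc]
      exact hstep _ (ih x hx) ⟨Pi.single i (-1), i, Or.inr rfl⟩
  have h2 : ∀ s : Finset (Fin d), p (∑ i ∈ s, Pi.single i (z i)) := by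
    classical
    intro s
    induction s using Finset.induction_on with
    | empty => simpa using h0
    | insert i s hi ih =>
      rw [sum_insert hi, add_comm]
      exact h1 i _ _ ih
  rw [← Finset.univ_sum_single z]
  exact h2 univ

/-- Failure of transience is shift-invariant, and in the glued environment every unit step has
positive probability. So being null passes from a site to each of its neighbours, and from 0 to the
whole lattice. -/
theorem ae_glueEnv_transient (hQ : UniformlyElliptic Q)
    (hA : 0 < jointLaw (envLaw Q) 0 (Prod.snd ⁻¹' transientPaths d)) :
    haveI := isProbabilityMeasure_slabLaw Q hA
    ∀ᵐ S ∂Measure.infinitePi fun _ : ℤ => slabLaw Q, ∀ z,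
      quenchedLaw (glueEnv S) z (transientPaths d)ᶜ = 0 := by
  have hslab := isProbabilityMeasure_slabLaw Q hA
  have hgood : ∀ᵐ S ∂Measure.infinitePi fun _ : ℤ => slabLaw Q,
      ∀ n, (S n).IsCrossing ∧ (S n).IsElliptic := ae_all_iff.2 fun n =>
    (measurePreserving_eval_infinitePi (fun _ : ℤ => slabLaw Q) n).quasiMeasurePreserving.ae
      (ae_slabLaw Q hQ hA)
  filter_upwards [hgood, ae_glueEnv_transient_zero Q hQ hA] with S hS h0
  refine lattice_induction h0 fun x hx e => ?_
  refine quenchedLaw_eq_zero_of_jump measurableSet_transientPaths.compl ?_ ?_ hx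
  · ext X
    exact not_congr shiftPath_mem_transientPaths_iff
  · have hcross : ∀ n, (S n).IsCrossing := fun n => (hS n).1
    obtain ⟨n, hn, -⟩ := existsUnique_inSlab hcross x
    rw [jump, Measure.map_apply Measurable.of_discrete (measurableSet_singleton _),
      glueEnv_apply hcross hn]
    refine ne_of_gt (lt_of_lt_of_le (pos_iff_ne_zero.2 ((hS n).2 _ hn e)) (measure_mono ?_))
    rintro _ rfl
    rfl

end Conclusion

end RWRE

end

theorem proposition3p2 {d : ℕ} [NeZero d] (Q : Measure (RWRE.StepLaw d)) [IsProbabilityMeasure Q]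
    (hQ : RWRE.UniformlyElliptic Q)
    (hA : 0 < RWRE.jointLaw (RWRE.envLaw Q) 0 (Prod.snd ⁻¹' RWRE.transientPaths d))
    (z : RWRE.Lattice d) :
    ∀ᵐ p ∂(RWRE.jointLaw (RWRE.backwardEnvLaw Q) z), p.2 ∈ RWRE.transientPaths d := by
  have hslab := RWRE.isProbabilityMeasure_slabLaw Q hA
  have hback := RWRE.isProbabilityMeasure_backwardEnvLaw Q hA
  have hm : MeasurableSet {p : RWRE.Env d × RWRE.Path d | p.2 ∈ RWRE.transientPaths d} :=
    measurable_snd RWRE.measurableSet_transientPaths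
  refine (Measure.ae_compProd_iff hm).2 ?_
  have hm' : MeasurableSet {ω : RWRE.Env d |
      RWRE.quenchedLaw ω z (RWRE.transientPaths d)ᶜ = 0} :=
    RWRE.measurable_quenchedLaw_apply z RWRE.measurableSet_transientPaths.compl
      (measurableSet_singleton 0)
  rw [RWRE.backwardEnvLaw, RWRE.backwardPathLaw,
    Measure.map_map measurable_fst RWRE.measurable_glue]
  refine (ae_map_iff (measurable_fst.comp RWRE.measurable_glue).aemeasurable hm').2 ?_
  filter_upwards [RWRE.ae_glueEnv_transient Q hQ hA] with S hS using hS z
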